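/- Fix an integer $d\ge 2$. **Model.** Let $n\ge d$, let $[n]=\{1,\dots,n\}$ and let $\mathcal E$ be the set of all $d$-element subsets of $[n]$ (edges). Let $\Phi^*$ be a labelling of $[n]$ in which every node either belongs to exactly one of $k$ disjoint clusters $C_1^*,\dots,C_k^*$, all of the same size $s$, or is an outlier that belongs to no cluster. Let $0\le q<p\le 1$ (the numbers $k,s,p,q$ may depend on $n$). In the balanced weighted $d$-uniform hypergraph planted clustering model ($d$-WHPCM) one observes independent random weights $W_e\in[0,1]$, $e\in\mathcal E$, with $\mathbb E[W_e]=p$ if $e\subseteq C_a^*$ for some $a$, and $\mathbb E[W_e]=q$ otherwise. The similarity matrix $\mathbf A\in\mathbb R^{n\times n}$ has entries $\mathbf A_{ij}=\sum_{e\in\mathcal E:\{i,j\}\subseteq e}W_e$ for $i\ne j$ and $\mathbf A_{ii}=0$. The ground-truth cluster matrix $\mathbf X^*\in\{0,1\}^{n\times n}$ has $\mathbf X^*_{ij}=1$ if and only if $i$ and $j$ belong to the same cluster (so $\mathbf X^*_{ii}=0$ for outliers). Consider the semidefinite program $$\max_{\mathbf X\in\mathbb R^{n\times n}}\ \langle \mathbf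 A,\mathbf X\rangle\quad\text{subject to}\quad \mathbf X\succeq 0,\quad 0\le \mathbf X_{ij}\le 1\ \ \forall i,j,\quad \operatorname{tr}\mathbf X=ks,\quad \sum_{i,j}\mathbf X_{ij}=ks^2. \tag{SDP}$$ **Theorem.** (i) There is a constant $c_4>0$, depending only on $d$, such that whenever $$ s^2\binom{s-2}{d-2}^2(p-q)^2\ \ge\ c_4\binom{n-2}{d-2}\,p\,\bigl(s\log n+n\bigr)$$ (where $\binom{s-2}{d-2}=0$ if $d\ge3$ and $s<2$, and $\binom{s-2}{0}=1$), the matrix $\mathbf X^*$ is the unique optimal solution of (SDP) with probability greater than $1-6n^{-11}$. (ii) As a consequence, planted cliques of size $\Omega(\sqrt n)$ are exactly recovered: there is a constant $K>0$, depending only on $d$, such that the following holds for every $n\ge1$ and every $\mathcal C\subseteq[n]$ with $s:=|\mathcal C|\ge K\sqrt n$. Let $\mathcal H$ be a random $d$-uniform hypergraph on $[n]$ in which the $d$-element subsets $e$ of $[n]$ appear independently as hyperedges, with probability $1$ if $e\subseteq\mathcal C$ and with probability $\tfrac12$ otherwise, and let $W_e\in\{0,1\}$ indicate whether $e$ is a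 hyperedge of $\mathcal H$. Then, with probability greater than $1-6n^{-11}$, the matrix $\mathbf 1_{\mathcal C}\mathbf 1_{\mathcal C}^{\top}$ is the unique optimal solution of (SDP) with $k=1$, and $\mathcal C=\{i:\mathbf X_{ii}=1\}$ for every optimal solution $\mathbf X$ of it. -/

import Mathlib

open MeasureTheory ProbabilityTheory

noncomputable section

namespace HypergraphClustering

/-- The `d`-regular edges on the vertex set `[n]`: the subsets of `[n]` with exactly `d` elements. -/
abbrev Edge (n d : ℕ) : Type := {e : Finset (Fin n) // e.card = d}

/-- The `a`-th hidden cluster of a labelling `Φ`. A label `some a` means membership in the `a`-th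
cluster, and the extra label `none` marks the outlier nodes. -/
def cluster {n k : ℕ} (Φ : Fin n → Option (Fin k)) (a : Fin k) : Finset (Fin n) :=
  Finset.univ.filter fun i => Φ i = some a

/-- An edge is `Φ`-homogeneous if it is contained in one of the `k` clusters (a set of outlier nodes
is not a cluster). -/
def Homogeneous {n k d : ℕ} (Φ : Fin n → Option (Fin k)) (e : Edge n d) : Prop :=
  ∃ a : Fin k, e.1 ⊆ cluster Φ a

/-- The membership matrix `Z ∈ {0,1}^{n × k}` of a labelling with outliers. -/
def membershipMatrix {n k : ℕ} (Φ : Fin n → Option (Fin k)) : Matrix (Fin n) (Fin k) ℝ :=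
  Matrix.of fun i a => if Φ i = some a then 1 else 0

/-- The cluster matrix `X = Z Zᵀ` of a labelling with outliers. -/
def clusterMatrix {n k : ℕ} (Φ : Fin n → Option (Fin k)) : Matrix (Fin n) (Fin n) ℝ :=
  membershipMatrix Φ * (membershipMatrix Φ).transpose

/-- The similarity matrix of the weighted `d`-uniform hypergraph `([n], w)`: the entry at `(i, j)`,
`i ≠ j`, is the total weight of the edges that contain `i` and `j`; the diagonal is zero. -/
def similarityMatrix {n d : ℕ} (w : Edge n d → ℝ) : Matrix (Fin n) (Fin n) ℝ :=
  Matrix.of fun i j =>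
    if i = j then 0 else ∑ e ∈ Finset.univ.filter (fun e : Edge n d => i ∈ e.1 ∧ j ∈ e.1), w e

/-- The entrywise inner product `⟨A, X⟩` of two real `n × n` matrices. -/
def entryInner {n : ℕ} (A X : Matrix (Fin n) (Fin n) ℝ) : ℝ :=
  ∑ i, ∑ j, A i j * X i j

/-- The feasible region of the semidefinite program with prescribed trace `τ` and prescribed sum
of all entries `σ`. -/
def sdpFeasible (n : ℕ) (τ σ : ℝ) : Set (Matrix (Fin n) (Fin n) ℝ) :=
  {X | X.PosSemidef ∧ (∀ i j, 0 ≤ X i j ∧ X i j ≤ 1) ∧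
    entryInner 1 X = τ ∧ entryInner (Matrix.of fun _ _ => 1) X = σ}

/-- `X` is an optimal solution of: maximize `⟨A, X⟩` over the feasible region. -/
def IsSDPOptimal {n : ℕ} (A : Matrix (Fin n) (Fin n) ℝ) (τ σ : ℝ)
    (X : Matrix (Fin n) (Fin n) ℝ) : Prop :=
  X ∈ sdpFeasible n τ σ ∧ ∀ Y ∈ sdpFeasible n τ σ, entryInner A Y ≤ entryInner A X

/-- `X` is the one and only optimal solution of the semidefinite program. -/
def IsUniqueSDPOptimal {n : ℕ} (A : Matrix (Fin n) (Fin n) ℝ) (τ σ : ℝ)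
    (X : Matrix (Fin n) (Fin n) ℝ) : Prop :=
  IsSDPOptimal A τ σ X ∧ ∀ Y, IsSDPOptimal A τ σ Y → Y = X

/-- The random weights `W` on the probability space `(Ω, μ)` are a sample of the weighted
`d`-uniform hypergraph planted clustering model: the `k` clusters all have size `s`, and the edges
carry independent weights in `[0, 1]` with mean `p` on homogeneous edges and mean `q < p` on all
other edges. Only the means are prescribed, not the distributions. -/
structure IsWHPCM {Ω : Type*} [MeasurableSpace Ω] (μ : Measure Ω) {n k d : ℕ} (s : ℕ) (p q : ℝ)
    (Φ : Fin n → Option (Fin k)) (W : Edge n d → Ω → ℝ) : Prop where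
  zero_le_q : 0 ≤ q
  q_lt_p : q < p
  p_le_one : p ≤ 1
  balanced : ∀ a, (cluster Φ a).card = s
  measurable : ∀ e, Measurable (W e)
  mem_unit : ∀ e, ∀ᵐ ω ∂μ, 0 ≤ W e ω ∧ W e ω ≤ 1
  indep : iIndepFun W μ
  mean_homogeneous : ∀ e, Homogeneous Φ e → ∫ ω, W e ω ∂μ = p
  mean_heterogeneous : ∀ e, ¬ Homogeneous Φ e → ∫ ω, W e ω ∂μ = q

/-- The random hypergraph with edge set `H ω` is a sample of the planted clique model with hidden
clique `C`: the edges appear independently, with probability `1` if they lie inside `C`, and with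
probability `1/2` otherwise. -/
structure IsPlantedClique {Ω : Type*} [MeasurableSpace Ω] (μ : Measure Ω) {n d : ℕ}
    (C : Finset (Fin n)) (H : Ω → Set (Edge n d)) : Prop where
  measurable : ∀ e, MeasurableSet {ω | e ∈ H ω}
  indep : iIndepSet (fun e : Edge n d => {ω | e ∈ H ω}) μ
  prob_inside : ∀ e : Edge n d, e.1 ⊆ C → μ.real {ω | e ∈ H ω} = 1
  prob_outside : ∀ e : Edge n d, ¬ e.1 ⊆ C → μ.real {ω | e ∈ H ω} = 1 / 2

open scoped Classical in
/-- The 0/1 edge weights of an unweighted `d`-uniform hypergraph with edge set `H`. -/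
def edgeIndicator {n d : ℕ} (H : Set (Edge n d)) (e : Edge n d) : ℝ :=
  if e ∈ H then 1 else 0

/-- The matrix `1_C 1_Cᵀ` of a vertex set `C`. -/
def cliqueMatrix {n : ℕ} (C : Finset (Fin n)) : Matrix (Fin n) (Fin n) ℝ :=
  Matrix.of fun i j => if i ∈ C ∧ j ∈ C then 1 else 0

end HypergraphClustering

end

/-! The proof combines a deterministic recovery criterion for perturbed block matrices with a
spectral bound on the noise.

Criterion (`isUniqueSDPOptimal_of_perturbation`). Off the diagonal, the mean of `A` is `b + c X*`
with `c = C(s-2, d-2) (p - q)`. For feasible `Y` put `H = X* - Y` and `δ = ⟨X*, H⟩`. The box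
constraints make `H` nonnegative on the blocks and nonpositive off them, and its entries sum to 0.
Hence `‖H‖₁ = 2δ`, and `δ = 0` forces `Y = X*`. The trace and sum constraints cancel `b`, and the
mean gains at least `c δ / 2`. Let `P = X*/s` be the projection onto the span of the cluster
indicators and `R = 1 - P`; then `H = PH + HP - PHP - RYR`. Against the first three terms the noise
`D` acts only through its averages over clusters, which Bernstein's inequality makes small
entrywise, paired with `‖H‖₁`. The last term is positive semidefinite of trace `δ/s`, so it costs at
most `‖D‖ δ / s`. No dual certificate is constructed.

Spectral bound (`spectral_tail`). With `N = C(n-2, d-2)`, one needs `‖D‖ = O(√(n N p))` with no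
logarithmic loss. The entries of `D` are dependent, since one edge feeds many entries. But every
functional `⟨A, F⟩` is a sum of independent edge weights, with coefficients at most `d² max |F|`
whose squares sum to at most `d² N ‖F‖²` in Frobenius norm. This is enough for the Kahn–Szemerédi
method. The unit ball is replaced by integer points of a ball of radius `4 √n`. Pairs with a small
product `z_i z_j` are handled by Bernstein and a union bound. Pairs with a large product are handled
by bounded row sums and a block discrepancy property. Throughout, `2 ^ g` stands for `√(n N p)` up
to a constant.

`snr_consequences` turns the signal condition into the inputs of both parts. The clique statement is
the case `k = 1`, `p = 1`, `q = 1/2`, where a large enough multiple of `√n` makes `N` at most a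
constant times `C(s-2, d-2)²`. -/

open MeasureTheory ProbabilityTheory

noncomputable section

namespace HypergraphClustering

/-! ### Exponential moment bounds for weighted sums of independent variables. -/

section Concentration

variable {Ω : Type*} [MeasurableSpace Ω] {μ : Measure Ω} [IsProbabilityMeasure μ]
  {ι : Type*} [Fintype ι]

/-- Exponential Markov inequality for sums of independent bounded variables. -/
lemma measureReal_sum_ge_le (X : ι → Ω → ℝ) (hm : ∀ e, Measurable (X e)) (hi : iIndepFun X μ)
    (hb : ∀ e, ∃ B, ∀ᵐ ω ∂μ, |X e ω| ≤ B) (b : ι → ℝ)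
    (h : ∀ e, ∫ ω, Real.exp (X e ω) ∂μ ≤ Real.exp (b e)) (t : ℝ) :
    μ.real {ω | t ≤ ∑ e, X e ω} ≤ Real.exp (∑ e, b e - t) := by
  have hint : Integrable (fun ω => Real.exp (1 * (∑ e, X e) ω)) μ := by
    choose B hB using hb
    refine Integrable.of_bound (C := Real.exp (∑ e, B e)) ?_ ?_
    · have : Measurable (∑ e, X e) := by
        have := Finset.measurable_sum (s := Finset.univ) (f := X) fun e _ => hm e
        rwa [← Finset.sum_fn] at this
      exact (Real.measurable_exp.comp (this.const_mul 1)).aestronglyMeasurable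
    · filter_upwards [(Filter.eventually_all).2 hB] with ω hω
      rw [Real.norm_eq_abs, Real.abs_exp, Real.exp_le_exp, one_mul, Finset.sum_apply]
      exact Finset.sum_le_sum fun e _ => (le_abs_self _).trans (hω e)
  -- The tilt is fixed at 1: any scaling is already part of `X`.
  have h1 := measure_ge_le_exp_mul_mgf (μ := μ) (X := ∑ e, X e) (t := 1) t zero_le_one hint
  rw [hi.mgf_sum hm] at h1
  simp only [Finset.sum_apply] at h1
  refine h1.trans ?_
  rw [sub_eq_add_neg, add_comm, Real.exp_add, Real.exp_sum, neg_one_mul]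
  refine mul_le_mul_of_nonneg_left ?_ (Real.exp_pos _).le
  refine Finset.prod_le_prod (fun e _ => mgf_nonneg) fun e _ => ?_
  simpa [mgf] using h e

variable {W : ι → Ω → ℝ} {p : ℝ}

lemma integrable_of_mem_unit {f : Ω → ℝ} (hm : Measurable f)
    (hb : ∀ᵐ ω ∂μ, 0 ≤ f ω ∧ f ω ≤ 1) : Integrable f μ := by
  refine Integrable.of_bound (C := 1) hm.aestronglyMeasurable ?_
  filter_upwards [hb] with ω hω
  rw [Real.norm_eq_abs, abs_le]
  constructor <;> linarith [hω.1, hω.2]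

/-- Chernoff's upper tail bound for weighted sums of independent `[0, 1]`-valued variables. -/
lemma chernoff_upper (hm : ∀ e, Measurable (W e)) (hi : iIndepFun W μ)
    (hb : ∀ e, ∀ᵐ ω ∂μ, 0 ≤ W e ω ∧ W e ω ≤ 1) (hp : ∀ e, ∫ ω, W e ω ∂μ ≤ p)
    (c : ι → ℝ) (hc : ∀ e, 0 ≤ c e ∧ c e ≤ 1) {l : ℝ} (hl : 0 ≤ l) (t : ℝ) :
    μ.real {ω | t ≤ l * ∑ e, c e * W e ω} ≤
      Real.exp (p * (∑ e, c e) * (Real.exp l - 1) - t) := by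
  have hl1 : 0 ≤ Real.exp l - 1 := by linarith [Real.add_one_le_exp l]
  have key := measureReal_sum_ge_le (μ := μ) (fun e ω => (l * c e) * W e ω)
    (fun e => (hm e).const_mul _)
    (hi.comp (fun e x => (l * c e) * x) fun e => measurable_const_mul _)
    (fun e => ⟨|l * c e|, by
      filter_upwards [hb e] with ω hω
      rw [abs_mul]
      exact mul_le_of_le_one_right (abs_nonneg _) (abs_le.2 ⟨by linarith [hω.1], hω.2⟩)⟩)
    (fun e => p * c e * (Real.exp l - 1)) (fun e => by
      calc ∫ ω, Real.exp (l * c e * W e ω) ∂μ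
          ≤ ∫ ω, (1 + c e * (Real.exp l - 1) * W e ω) ∂μ := by
            refine integral_mono_of_nonneg (Filter.Eventually.of_forall fun ω => (Real.exp_pos _).le)
              ((integrable_const _).add ((integrable_of_mem_unit (hm e) (hb e)).const_mul _)) ?_
            filter_upwards [hb e] with ω hω
            have hx0 : 0 ≤ c e * W e ω := mul_nonneg (hc e).1 hω.1
            have hx1 : c e * W e ω ≤ 1 := mul_le_one₀ (hc e).2 hω.1 hω.2
            -- On `[0, l]` the exponential lies below its chord, used at the point `c e * W e ω *
            -- l`.
            have := convexOn_exp.2 (Set.mem_univ 0) (Set.mem_univ l)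
              (sub_nonneg.2 hx1) hx0 (by ring)
            simp only [smul_eq_mul, mul_zero, zero_add, Real.exp_zero, mul_one] at this
            rw [show l * c e * W e ω = c e * W e ω * l by ring]
            linarith
        _ = 1 + c e * (Real.exp l - 1) * ∫ ω, W e ω ∂μ := by
            rw [integral_add (integrable_const _)
              ((integrable_of_mem_unit (hm e) (hb e)).const_mul _), integral_const_mul]
            simp
        _ ≤ 1 + p * c e * (Real.exp l - 1) := by
            have := mul_le_mul_of_nonneg_left (hp e) (mul_nonneg (hc e).1 hl1)
            linarith
        _ ≤ _ := by linarith [Real.add_one_le_exp (p * c e * (Real.exp l - 1))]) t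
  have e1 : ∀ ω, ∑ e, l * c e * W e ω = l * ∑ e, c e * W e ω := fun ω => by
    rw [Finset.mul_sum]; exact Finset.sum_congr rfl fun e _ => by ring
  have e2 : ∑ e, p * c e * (Real.exp l - 1) = p * (∑ e, c e) * (Real.exp l - 1) := by
    rw [Finset.mul_sum, Finset.sum_mul]
  simpa only [e1, e2] using key

/-- `e^x ≤ 1 + x + x²` on `[-1, 1]`, and `W² ≤ W` bounds the variance by `p`. The tilt is again
absorbed in the coefficients `c`. -/
lemma bernstein_upper (hm : ∀ e, Measurable (W e)) (hi : iIndepFun W μ)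
    (hb : ∀ e, ∀ᵐ ω ∂μ, 0 ≤ W e ω ∧ W e ω ≤ 1) (hp : ∀ e, ∫ ω, W e ω ∂μ ≤ p)
    (c : ι → ℝ) (hc : ∀ e, |c e| ≤ 1) (t : ℝ) :
    μ.real {ω | t ≤ ∑ e, c e * (W e ω - ∫ ω, W e ω ∂μ)} ≤
      Real.exp (p * (∑ e, c e ^ 2) - t) := by
  have hWi := fun e => integrable_of_mem_unit (hm e) (hb e)
  have hm0 : ∀ e, 0 ≤ ∫ ω, W e ω ∂μ := fun e =>
    integral_nonneg_of_ae ((hb e).mono fun ω h => h.1)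
  have hm1 : ∀ e, ∫ ω, W e ω ∂μ ≤ 1 := fun e => by
    have := integral_mono_ae (hWi e) (integrable_const (1 : ℝ)) ((hb e).mono fun ω h => h.2)
    simpa using this
  have hbd : ∀ e, ∀ᵐ ω ∂μ, |c e * (W e ω - ∫ ω, W e ω ∂μ)| ≤ 1 := fun e => by
    filter_upwards [hb e] with ω hω
    rw [abs_mul]
    refine mul_le_one₀ (hc e) (abs_nonneg _) (abs_le.2 ⟨?_, ?_⟩) <;>
      linarith [hω.1, hω.2, hm0 e, hm1 e]
  have key := measureReal_sum_ge_le (μ := μ)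
    (fun e ω => c e * (W e ω - ∫ ω, W e ω ∂μ))
    (fun e => ((hm e).sub_const _).const_mul _)
    (hi.comp (fun e x => c e * (x - ∫ ω, W e ω ∂μ)) fun e => by fun_prop)
    (fun e => ⟨1, hbd e⟩) (fun e => p * c e ^ 2) (fun e => by
      have hsq : Integrable (fun ω => W e ω ^ 2) μ :=
        integrable_of_mem_unit ((hm e).pow_const 2) ((hb e).mono fun ω h =>
          ⟨sq_nonneg _, pow_le_one₀ h.1 h.2⟩)
      have hsqle : ∫ ω, W e ω ^ 2 ∂μ ≤ p :=
        (integral_mono_ae hsq (hWi e) ((hb e).mono fun ω h => by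
          simpa using pow_le_of_le_one h.1 h.2 two_ne_zero)).trans (hp e)
      set m := ∫ ω, W e ω ∂μ with hmdef
      have h1 : Integrable (fun ω => c e * W e ω) μ := (hWi e).const_mul _
      have h2 : Integrable (fun ω => c e ^ 2 * W e ω ^ 2) μ := hsq.const_mul _
      have h3 : Integrable (fun ω => (2 * c e ^ 2 * m) * W e ω) μ := (hWi e).const_mul _
      have h4 : Integrable (fun ω => (1 - c e * m + c e ^ 2 * m ^ 2) + c e * W e ω) μ :=
        (integrable_const _).add h1
      have h5 : Integrable (fun ω => (1 - c e * m + c e ^ 2 * m ^ 2) + c e * W e ω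
        + c e ^ 2 * W e ω ^ 2) μ := h4.add h2
      calc ∫ ω, Real.exp (c e * (W e ω - m)) ∂μ
          ≤ ∫ ω, ((1 - c e * m + c e ^ 2 * m ^ 2) + c e * W e ω + c e ^ 2 * W e ω ^ 2
              - (2 * c e ^ 2 * m) * W e ω) ∂μ := by
            refine integral_mono_of_nonneg (Filter.Eventually.of_forall fun ω => (Real.exp_pos _).le)
              (h5.sub h3) ?_
            filter_upwards [hbd e] with ω hω
            have := (abs_le.1 (Real.abs_exp_sub_one_sub_id_le hω)).2
            nlinarith [this]
        _ = (1 - c e * m + c e ^ 2 * m ^ 2) + c e * m + c e ^ 2 * ∫ ω, W e ω ^ 2 ∂μ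
              - (2 * c e ^ 2 * m) * m := by
            rw [integral_sub h5 h3, integral_add h4 h2, integral_add (integrable_const _) h1,
              integral_const_mul, integral_const_mul, integral_const_mul]
            simp [hmdef]
        _ ≤ 1 + p * c e ^ 2 := by
            have := mul_le_mul_of_nonneg_left hsqle (sq_nonneg (c e))
            nlinarith [mul_nonneg (sq_nonneg (c e)) (sq_nonneg m)]
        _ ≤ _ := by linarith [Real.add_one_le_exp (p * c e ^ 2)]) t
  simpa only [Finset.mul_sum] using key

/-- Bernstein's inequality for weighted sums of independent centered `[0, 1]`-valued variables. -/
lemma bernstein_abs (hm : ∀ e, Measurable (W e)) (hi : iIndepFun W μ)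
    (hb : ∀ e, ∀ᵐ ω ∂μ, 0 ≤ W e ω ∧ W e ω ≤ 1) (hp : ∀ e, ∫ ω, W e ω ∂μ ≤ p)
    (c : ι → ℝ) (hc : ∀ e, |c e| ≤ 1) (t : ℝ) :
    μ.real {ω | t ≤ |∑ e, c e * (W e ω - ∫ ω, W e ω ∂μ)|} ≤
      2 * Real.exp (p * (∑ e, c e ^ 2) - t) := by
  have h1 := bernstein_upper hm hi hb hp c hc t
  have h2 := bernstein_upper hm hi hb hp (fun e => - c e) (fun e => by simpa using hc e) t
  simp only [neg_mul, Finset.sum_neg_distrib, neg_sq] at h2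
  have hsub : {ω | t ≤ |∑ e, c e * (W e ω - ∫ ω, W e ω ∂μ)|} ⊆
      {ω | t ≤ ∑ e, c e * (W e ω - ∫ ω, W e ω ∂μ)} ∪
      {ω | t ≤ -∑ e, c e * (W e ω - ∫ ω, W e ω ∂μ)} := by
    intro ω hω
    rw [Set.mem_ofPred_eq] at hω
    exact (le_abs.1 hω).imp id id
  have := (measureReal_mono (μ := μ) hsub).trans (measureReal_union_le _ _)
  linarith

end Concentration

/-! ### Linear functionals of the similarity matrix as sums over edges. -/

section PairSums

variable {n d : ℕ}

/-- The sum of the entries of `F` over the ordered pairs of distinct nodes of the edge `e`. -/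
def pairSum (F : Matrix (Fin n) (Fin n) ℝ) (e : Edge n d) : ℝ :=
  ∑ x ∈ e.1.offDiag, F x.1 x.2

lemma sum_pairSum_mul (w : Edge n d → ℝ) (F : Matrix (Fin n) (Fin n) ℝ) :
    ∑ e, pairSum F e * w e = ∑ x ∈ (Finset.univ : Finset (Fin n)).offDiag,
      ∑ e ∈ Finset.univ.filter (fun e : Edge n d => x.1 ∈ e.1 ∧ x.2 ∈ e.1), F x.1 x.2 * w e := by
  simp only [pairSum, Finset.sum_mul]
  refine Finset.sum_comm' fun e x => ?_
  simp only [Finset.mem_univ, Finset.mem_offDiag, Finset.mem_filter, true_and]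
  tauto

lemma entryInner_eq_sum_offDiag {A : Matrix (Fin n) (Fin n) ℝ} (hA : ∀ i, A i i = 0)
    (F : Matrix (Fin n) (Fin n) ℝ) :
    entryInner A F = ∑ x ∈ (Finset.univ : Finset (Fin n)).offDiag, A x.1 x.2 * F x.1 x.2 := by
  rw [entryInner, ← Finset.sum_product', Finset.univ_product_univ]
  symm
  refine Finset.sum_subset (Finset.subset_univ _) fun x _ hx => ?_
  have : x.1 = x.2 := by simpa [Finset.mem_offDiag] using hx
  rw [this, hA, zero_mul]

lemma similarityMatrix_diag (w : Edge n d → ℝ) (i : Fin n) : similarityMatrix w i i = 0 := by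
  simp [similarityMatrix]

lemma similarityMatrix_symm (w : Edge n d → ℝ) (i j : Fin n) :
    similarityMatrix w i j = similarityMatrix w j i := by
  simp only [similarityMatrix, Matrix.of_apply, eq_comm (a := i) (b := j),
    and_comm (a := i ∈ _) (b := j ∈ _)]

lemma similarityMatrix_nonneg {w : Edge n d → ℝ} (hw : ∀ e, 0 ≤ w e) (i j : Fin n) :
    0 ≤ similarityMatrix w i j := by
  simp only [similarityMatrix, Matrix.of_apply]
  split_ifs
  exacts [le_rfl, Finset.sum_nonneg fun e _ => hw e]

lemma similarityMatrix_sub (w v : Edge n d → ℝ) :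
    similarityMatrix (fun e => w e - v e) = similarityMatrix w - similarityMatrix v := by
  ext i j
  by_cases h : i = j <;> simp [similarityMatrix, h]

lemma entryInner_similarityMatrix (w : Edge n d → ℝ) (F : Matrix (Fin n) (Fin n) ℝ) :
    entryInner (similarityMatrix w) F = ∑ e, pairSum F e * w e := by
  rw [entryInner_eq_sum_offDiag (similarityMatrix_diag w), sum_pairSum_mul]
  refine Finset.sum_congr rfl fun x hx => ?_
  rw [similarityMatrix, Matrix.of_apply, if_neg (by simpa [Finset.mem_offDiag] using hx),
    Finset.sum_mul]
  exact Finset.sum_congr rfl fun e _ => mul_comm _ _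

lemma card_edges_containing_pair (hd : 2 ≤ d) {i j : Fin n} (hij : i ≠ j) (S : Finset (Fin n))
    (hi : i ∈ S) (hj : j ∈ S) :
    (Finset.univ.filter fun e : Edge n d => (i ∈ e.1 ∧ j ∈ e.1) ∧ e.1 ⊆ S).card =
      (S.card - 2).choose (d - 2) := by
  have hsub : ({i, j} : Finset (Fin n)) ⊆ S := by
    intro x; simp only [Finset.mem_insert, Finset.mem_singleton]; rintro (rfl | rfl) <;> assumption
  have hc : (S \ {i, j}).card = S.card - 2 := by
    rw [Finset.card_sdiff_of_subset hsub, Finset.card_pair hij]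
  rw [← hc, ← Finset.card_powersetCard]
  refine Finset.card_bij' (fun e _ => e.1 \ {i, j})
    (fun t ht => ⟨t ∪ {i, j}, ?_⟩) ?_ ?_ ?_ ?_
  · rw [Finset.mem_powersetCard, Finset.subset_sdiff] at ht
    rw [Finset.card_union_of_disjoint ht.1.2, Finset.card_pair hij, ht.2]
    omega
  · intro e he
    simp only [Finset.mem_filter, Finset.mem_univ, true_and] at he
    have hs : ({i, j} : Finset (Fin n)) ⊆ e.1 := by
      intro x; simp only [Finset.mem_insert, Finset.mem_singleton]
      rintro (rfl | rfl)
      exacts [he.1.1, he.1.2]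
    rw [Finset.mem_powersetCard, Finset.card_sdiff_of_subset hs, Finset.card_pair hij, e.2]
    exact ⟨Finset.sdiff_subset_sdiff he.2 le_rfl, rfl⟩
  · intro t ht
    rw [Finset.mem_powersetCard, Finset.subset_sdiff] at ht
    simp only [Finset.mem_filter, Finset.mem_univ, true_and]
    refine ⟨by simp, Finset.union_subset ht.1.1 hsub⟩
  · intro e he
    simp only [Finset.mem_filter, Finset.mem_univ, true_and] at he
    have hs : ({i, j} : Finset (Fin n)) ⊆ e.1 := by
      intro x; simp only [Finset.mem_insert, Finset.mem_singleton]
      rintro (rfl | rfl)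
      exacts [he.1.1, he.1.2]
    exact Subtype.ext (Finset.sdiff_union_of_subset hs)
  · intro t ht
    rw [Finset.mem_powersetCard, Finset.subset_sdiff] at ht
    exact Finset.union_sdiff_cancel_right ht.1.2

lemma card_edges_containing (hd : 2 ≤ d) {i j : Fin n} (hij : i ≠ j) :
    (Finset.univ.filter fun e : Edge n d => i ∈ e.1 ∧ j ∈ e.1).card =
      (n - 2).choose (d - 2) := by
  simpa using card_edges_containing_pair hd hij Finset.univ (Finset.mem_univ _) (Finset.mem_univ _)

/-- The number of edges through two given distinct nodes. -/
abbrev codegree (n d : ℕ) : ℝ := ((n - 2).choose (d - 2) : ℝ)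

/-- Double counting: an ordered pair of distinct nodes lies in `codegree n d` edges. The diagonal of
`F` only enlarges the right side. -/
lemma sum_pairSum_le (hd : 2 ≤ d) {F : Matrix (Fin n) (Fin n) ℝ} (hF : ∀ i j, 0 ≤ F i j) :
    ∑ e : Edge n d, pairSum F e ≤ codegree n d * ∑ i, ∑ j, F i j := by
  have h := sum_pairSum_mul (fun _ : Edge n d => (1 : ℝ)) F
  simp only [mul_one] at h
  rw [h, ← Fintype.sum_prod_type' (f := fun i j => F i j), Finset.mul_sum]
  calc _ = ∑ x ∈ (Finset.univ : Finset (Fin n)).offDiag, codegree n d * F x.1 x.2 := by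
        refine Finset.sum_congr rfl fun x hx => ?_
        rw [Finset.sum_const, nsmul_eq_mul,
          card_edges_containing hd (by simpa [Finset.mem_offDiag] using hx)]
    _ ≤ _ := Finset.sum_le_sum_of_subset_of_nonneg (Finset.subset_univ _)
        fun x _ _ => mul_nonneg (Nat.cast_nonneg _) (hF _ _)

lemma card_offDiag_le (e : Edge n d) : (e.1.offDiag.card : ℝ) ≤ (d : ℝ) ^ 2 := by
  rw [Finset.offDiag_card, e.2, sq]
  exact_mod_cast Nat.sub_le _ _

lemma pairSum_nonneg {F : Matrix (Fin n) (Fin n) ℝ} (hF : ∀ i j, 0 ≤ F i j) (e : Edge n d) :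
    0 ≤ pairSum F e := Finset.sum_nonneg fun _ _ => hF _ _

lemma abs_pairSum_le {F : Matrix (Fin n) (Fin n) ℝ} {c : ℝ} (hc : 0 ≤ c)
    (hF : ∀ i j, |F i j| ≤ c) (e : Edge n d) : |pairSum F e| ≤ (d : ℝ) ^ 2 * c := by
  calc |pairSum F e| ≤ ∑ x ∈ e.1.offDiag, |F x.1 x.2| := Finset.abs_sum_le_sum_abs _ _
    _ ≤ ∑ x ∈ e.1.offDiag, c := Finset.sum_le_sum fun x _ => hF _ _
    _ = e.1.offDiag.card * c := by rw [Finset.sum_const, nsmul_eq_mul]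
    _ ≤ _ := mul_le_mul_of_nonneg_right (card_offDiag_le e) hc

lemma sq_pairSum_le (F : Matrix (Fin n) (Fin n) ℝ) (e : Edge n d) :
    pairSum F e ^ 2 ≤ (d : ℝ) ^ 2 * pairSum (Matrix.of fun i j => F i j ^ 2) e := by
  refine (sq_sum_le_card_mul_sum_sq (s := e.1.offDiag) (f := fun x => F x.1 x.2)).trans ?_
  exact mul_le_mul_of_nonneg_right (card_offDiag_le e) (pairSum_nonneg (fun _ _ => sq_nonneg _) e)

/-- Cauchy–Schwarz over the at most `d²` pairs inside an edge, then double counting. This variance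
bound takes the place of independence of the matrix entries. -/
lemma sum_sq_pairSum_le (hd : 2 ≤ d) (F : Matrix (Fin n) (Fin n) ℝ) :
    ∑ e : Edge n d, pairSum F e ^ 2 ≤ (d : ℝ) ^ 2 * (codegree n d * ∑ i, ∑ j, F i j ^ 2) := by
  refine (Finset.sum_le_sum fun e _ => sq_pairSum_le F e).trans ?_
  rw [← Finset.mul_sum]
  exact mul_le_mul_of_nonneg_left (sum_pairSum_le hd fun _ _ => sq_nonneg _) (by positivity)

end PairSums

/-! ### Tail bounds for linear functionals of the similarity matrix. -/

section Tails

variable {n d : ℕ} {Ω : Type*} [MeasurableSpace Ω] {μ : Measure Ω} [IsProbabilityMeasure μ]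
  {W : Edge n d → Ω → ℝ} {p : ℝ}

/-- The centered similarity matrix. -/
def deviation (μ : Measure Ω) (W : Edge n d → Ω → ℝ) (ω : Ω) : Matrix (Fin n) (Fin n) ℝ :=
  similarityMatrix fun e => W e ω - ∫ ω, W e ω ∂μ

/-- Dividing by `d²` brings the edge coefficients into `[0, 1]`, as `chernoff_upper` requires. -/
lemma entryInner_similarity_upper (hd : 2 ≤ d) (hp0 : 0 ≤ p)
    (hm : ∀ e, Measurable (W e)) (hi : iIndepFun W μ)
    (hb : ∀ e, ∀ᵐ ω ∂μ, 0 ≤ W e ω ∧ W e ω ≤ 1) (hp : ∀ e, ∫ ω, W e ω ∂μ ≤ p)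
    {F : Matrix (Fin n) (Fin n) ℝ} (hF : ∀ i j, 0 ≤ F i j ∧ F i j ≤ 1)
    {l : ℝ} (hl : 0 ≤ l) (t : ℝ) :
    μ.real {ω | (d : ℝ) ^ 2 * t ≤ l * entryInner (similarityMatrix fun e => W e ω) F} ≤
      Real.exp (p * (codegree n d * ∑ i, ∑ j, F i j) / d ^ 2 * (Real.exp l - 1) - t) := by
  have hd0 : (0 : ℝ) < (d : ℝ) ^ 2 := by positivity
  have h := chernoff_upper hm hi hb hp (fun e => pairSum F e / d ^ 2) (fun e => by
    refine ⟨div_nonneg (pairSum_nonneg (fun i j => (hF i j).1) e) hd0.le, ?_⟩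
    rw [div_le_one hd0]
    refine (le_abs_self _).trans ?_
    simpa using abs_pairSum_le zero_le_one
      (fun i j => abs_le.2 ⟨by linarith [(hF i j).1], (hF i j).2⟩) e) hl t
  have hset : {ω | (d : ℝ) ^ 2 * t ≤ l * entryInner (similarityMatrix fun e => W e ω) F} =
      {ω | t ≤ l * ∑ e, pairSum F e / d ^ 2 * W e ω} := by
    ext ω
    rw [Set.mem_ofPred_eq, Set.mem_ofPred_eq, entryInner_similarityMatrix,
      show l * ∑ e, pairSum F e / (d : ℝ) ^ 2 * W e ω = (l * ∑ e, pairSum F e * W e ω) / d ^ 2 by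
        rw [mul_div_assoc, Finset.sum_div]
        congr 1
        exact Finset.sum_congr rfl fun e _ => by ring, le_div_iff₀ hd0, mul_comm t]
  rw [hset]
  refine h.trans (Real.exp_le_exp.2 (sub_le_sub_right ?_ _))
  rw [← Finset.sum_div, ← mul_div_assoc]
  have := Real.add_one_le_exp l
  refine mul_le_mul_of_nonneg_right (div_le_div_of_nonneg_right
    (mul_le_mul_of_nonneg_left (sum_pairSum_le hd fun i j => (hF i j).1) hp0) hd0.le) (by linarith)

lemma entryInner_deviation_abs (hd : 2 ≤ d) (hp0 : 0 ≤ p)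
    (hm : ∀ e, Measurable (W e)) (hi : iIndepFun W μ)
    (hb : ∀ e, ∀ᵐ ω ∂μ, 0 ≤ W e ω ∧ W e ω ≤ 1) (hp : ∀ e, ∫ ω, W e ω ∂μ ≤ p)
    {F : Matrix (Fin n) (Fin n) ℝ} {l : ℝ} (hl : 0 < l)
    (hF : ∀ i j, l * d ^ 2 * |F i j| ≤ 1) (t : ℝ) :
    μ.real {ω | t ≤ l * |entryInner (deviation μ W ω) F|} ≤
      2 * Real.exp (p * (l ^ 2 * d ^ 2 * (codegree n d * ∑ i, ∑ j, F i j ^ 2)) - t) := by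
  have hd0 : (0 : ℝ) < (d : ℝ) ^ 2 := by positivity
  have h := bernstein_abs hm hi hb hp (fun e => l * pairSum F e) (fun e => by
    have := abs_pairSum_le (c := 1 / (l * d ^ 2)) (by positivity) (fun i j => by
      rw [le_div_iff₀ (by positivity), mul_comm]; exact hF i j) e
    rw [abs_mul, abs_of_pos hl]
    calc l * |pairSum F e| ≤ l * (d ^ 2 * (1 / (l * d ^ 2))) :=
          mul_le_mul_of_nonneg_left this hl.le
      _ = 1 := by field_simp) t
  have hset : {ω | t ≤ l * |entryInner (deviation μ W ω) F|} =
      {ω | t ≤ |∑ e, l * pairSum F e * (W e ω - ∫ ω, W e ω ∂μ)|} := by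
    ext ω
    rw [Set.mem_ofPred_eq, Set.mem_ofPred_eq, deviation, entryInner_similarityMatrix]
    simp only [mul_assoc]
    rw [← Finset.mul_sum, abs_mul, abs_of_pos hl]
  rw [hset]
  refine h.trans (mul_le_mul_of_nonneg_left (Real.exp_le_exp.2 (sub_le_sub_right ?_ _)) zero_le_two)
  refine mul_le_mul_of_nonneg_left ?_ hp0
  simp only [mul_pow]
  rw [← Finset.mul_sum, mul_assoc]
  exact mul_le_mul_of_nonneg_left (sum_sq_pairSum_le hd F) (sq_nonneg _)

end Tails

/-! ### Heavy pairs: dyadic decomposition and discrepancy. -/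

section HeavyPairs

variable {n : ℕ}

/-- The total weight of `A` on the block `S × T`. -/
def blockSum (A : Matrix (Fin n) (Fin n) ℝ) (S T : Finset (Fin n)) : ℝ :=
  ∑ i ∈ S, ∑ j ∈ T, A i j

/-- The Chernoff parameter at which blocks with larger side of size `t` are tested. -/
def tilt (n t j : ℕ) : ℝ := (1 + Real.log (n / t)) / 4 * (2 / 3) ^ j

/-- The discrepancy property of a nonnegative matrix: no block has much more than its expected
weight. -/
def Discrepancy (A : Matrix (Fin n) (Fin n) ℝ) (D K : ℝ) : Prop :=
  ∀ T : Finset (Fin n), T.Nonempty → ∀ S ⊆ T, ∀ j < 32 * n,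
    tilt n T.card j * blockSum A S T ≤
      D / n * (S.card * T.card) * (Real.exp (tilt n T.card j) - 1)
        + K * (T.card * (1 + Real.log (n / T.card)))

/-- Nested sets rather than dyadic shells: the higher level is then contained in the lower one, as
`Discrepancy` requires. -/
def superlevel (w : Fin n → ℕ) (b : ℕ) : Finset (Fin n) :=
  Finset.univ.filter fun i => 2 ^ b ≤ w i

lemma superlevel_anti (w : Fin n → ℕ) {a b : ℕ} (h : b ≤ a) : superlevel w a ⊆ superlevel w b := by
  intro i
  simp only [superlevel, Finset.mem_filter, Finset.mem_univ, true_and]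
  exact (Nat.pow_le_pow_right two_pos h).trans

lemma geom_sum_four_le (m : ℕ) : ∑ b ∈ Finset.range (m + 1), (4 : ℝ) ^ b ≤ 2 * 4 ^ m := by
  induction m with
  | zero => norm_num
  | succ m ih => rw [Finset.sum_range_succ]; rw [pow_succ] at *; linarith [pow_pos (by norm_num : (0:ℝ) < 4) m]

lemma card_superlevel_mul_le (w : Fin n → ℕ) (b : ℕ) :
    ((superlevel w b).card : ℝ) * 4 ^ b ≤ ∑ i, (w i : ℝ) ^ 2 := by
  calc ((superlevel w b).card : ℝ) * 4 ^ b = ∑ i ∈ superlevel w b, (4 : ℝ) ^ b := by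
        rw [Finset.sum_const, nsmul_eq_mul]
    _ ≤ ∑ i ∈ superlevel w b, (w i : ℝ) ^ 2 := Finset.sum_le_sum fun i hi => by
        have : 2 ^ b ≤ w i := by simpa [superlevel] using hi
        have h2 : ((2 : ℝ) ^ b) ≤ w i := by exact_mod_cast this
        calc (4 : ℝ) ^ b = (2 ^ b) ^ 2 := by rw [← pow_mul, mul_comm, pow_mul]; norm_num
          _ ≤ _ := pow_le_pow_left₀ (by positivity) h2 2
    _ ≤ _ := Finset.sum_le_sum_of_subset_of_nonneg (Finset.subset_univ _)
        fun _ _ _ => sq_nonneg _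

/-- After exchanging the sums, each node contributes a geometric series dominated by its top term,
which is at most `w i ^ 2`. -/
lemma sum_card_superlevel_le (w : Fin n → ℕ) (B : ℕ) :
    ∑ b ∈ Finset.range B, 4 ^ b * ((superlevel w b).card : ℝ) ≤ 2 * ∑ i, (w i : ℝ) ^ 2 := by
  have h : ∀ b, 4 ^ b * ((superlevel w b).card : ℝ) =
      ∑ i, if 2 ^ b ≤ w i then (4 : ℝ) ^ b else 0 := fun b => by
    rw [← Finset.sum_filter, Finset.sum_const, nsmul_eq_mul, mul_comm]; rfl
  simp only [h]
  rw [Finset.sum_comm, Finset.mul_sum]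
  refine Finset.sum_le_sum fun i _ => ?_
  rcases Nat.eq_zero_or_pos (w i) with h0 | h0
  · simp [h0]
  rw [← Finset.sum_filter]
  have hp : (2 : ℝ) ^ Nat.log 2 (w i) ≤ w i := by exact_mod_cast Nat.pow_log_le_self 2 h0.ne'
  calc _ ≤ ∑ b ∈ Finset.range (Nat.log 2 (w i) + 1), (4 : ℝ) ^ b := by
        refine Finset.sum_le_sum_of_subset_of_nonneg (fun b hb => ?_) fun _ _ _ => by positivity
        rw [Finset.mem_range, Nat.lt_succ_iff]
        exact Nat.le_log_of_pow_le one_lt_two (Finset.mem_filter.1 hb).2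
    _ ≤ 2 * 4 ^ Nat.log 2 (w i) := geom_sum_four_le _
    _ = 2 * (2 ^ Nat.log 2 (w i)) ^ 2 := by
        rw [← pow_mul, mul_comm (Nat.log 2 (w i)), pow_mul]; norm_num
    _ ≤ _ := by gcongr

/-- The weight of a block of two superlevel sets, from the discrepancy property. -/
lemma block_bound {n b g j : ℕ} {s t e K : ℝ} (hn : 0 < n) (hs : 0 ≤ s) (ht : 1 ≤ t) (htn : t ≤ n)
    (hs4 : s * 4 ^ (b + g) ≤ 16 * n * 4 ^ j) (ht4 : t * 4 ^ b ≤ 16 * n)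
    {l : ℝ} (hl : l = (1 + Real.log (n / t)) / 4 * (2 / 3) ^ j)
    (h : l * e ≤ 4 ^ g / n * (s * t) * (Real.exp l - 1) + K * (t * (1 + Real.log (n / t)))) :
    4 ^ b * (1 / 2) ^ j * e ≤
      4 * K * (4 ^ b * t) * (3 / 4) ^ j + 16 * t * 2 ^ j + 128 * n * (1 / 2) ^ b * (4 / 3) ^ j := by
  have hn' : (0 : ℝ) < n := by exact_mod_cast hn
  have ht0 : 0 < t := by linarith
  set L := 1 + Real.log (n / t) with hL
  have hL1 : 1 ≤ L := by
    have := Real.log_nonneg ((one_le_div ht0).2 htn)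
    linarith
  set r : ℝ := (2 / 3) ^ j with hr
  have hr0 : 0 < r := by positivity
  have hr1 : r ≤ 1 := pow_le_one₀ (by norm_num) (by norm_num)
  have hl0 : 0 < l := by rw [hl]; positivity
  -- `Y = √(e n / t)`. The factor `1/4` in the tilt leaves room for `l e^l ≤ r Y`.
  set Y := Real.exp (L / 2) with hY
  have hYsq : Y ^ 2 = Real.exp 1 * (n / t) := by
    rw [hY, ← Real.exp_nat_mul, show ((2 : ℕ) : ℝ) * (L / 2) = 1 + Real.log (n / t) by
      push_cast; rw [hL]; ring, Real.exp_add, Real.exp_log (by positivity)]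
  have htY : t * Y ≤ 8 * n * (1 / 2) ^ b := by
    rw [← pow_le_pow_iff_left₀ (by positivity) (by positivity) two_ne_zero, mul_pow, hYsq]
    have e1 : (1 / 2 : ℝ) ^ b * (1 / 2) ^ b * 4 ^ b = 1 := by rw [← mul_pow, ← mul_pow]; norm_num
    calc t ^ 2 * (Real.exp 1 * (n / t)) = Real.exp 1 * (n * t) := by field_simp
      _ ≤ 4 * (n * t) := by
        gcongr
        linarith [Real.exp_one_lt_d9]
      _ = 4 * n * (t * 4 ^ b) * ((1 / 2 : ℝ) ^ b * (1 / 2) ^ b) := by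
        linear_combination (-(4 * n * t)) * e1
      _ ≤ 4 * n * (16 * n) * ((1 / 2 : ℝ) ^ b * (1 / 2) ^ b) := by gcongr
      _ = _ := by ring
  have hle : l * Real.exp l ≤ r * Y := by
    have h1 : L / 4 ≤ Real.exp (L / 4) := by linarith [Real.add_one_le_exp (L / 4)]
    have h2 : Real.exp l ≤ Real.exp (L / 4) := by
      rw [Real.exp_le_exp, hl]
      exact mul_le_of_le_one_right (by positivity) hr1
    have h3 : Y = Real.exp (L / 4) * Real.exp (L / 4) := by rw [← Real.exp_add, hY]; congr 1; ring
    rw [h3, hl]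
    rw [hl] at h2
    calc L / 4 * r * Real.exp (L / 4 * r) ≤ Real.exp (L / 4) * r * Real.exp (L / 4) := by gcongr
      _ = _ := by ring
  -- Bounding `e^l - 1` by a multiple of `l` lets the factor `l` cancel from the discrepancy
  -- inequality.
  have hexp : Real.exp l - 1 ≤ l * (1 + r * Y) := by
    have h1 : Real.exp l - l * Real.exp l ≤ 1 := by
      have := mul_le_mul_of_nonneg_left (Real.add_one_le_exp (-l)) (Real.exp_pos l).le
      rw [← Real.exp_add, add_neg_cancel, Real.exp_zero] at this
      linarith
    have h2 : l * Real.exp l ≤ l * (1 + l * Real.exp l) := by gcongr; linarith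
    have h3 : l * (1 + l * Real.exp l) ≤ l * (1 + r * Y) := by gcongr
    linarith
  have hpow : (4 : ℝ) ^ b * (1 / 2) ^ j * (4 ^ g / n * (s * t)) ≤ 16 * t * 2 ^ j := by
    have e1 : (4 : ℝ) ^ j = 2 ^ j * 2 ^ j := by rw [← mul_pow]; norm_num
    have e2 : (1 / 2 : ℝ) ^ j * 2 ^ j = 1 := by rw [← mul_pow]; norm_num
    calc (4 : ℝ) ^ b * (1 / 2) ^ j * (4 ^ g / n * (s * t))
        = (s * 4 ^ (b + g)) * ((1 / 2) ^ j * t / n) := by rw [pow_add]; ring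
      _ ≤ (16 * n * 4 ^ j) * ((1 / 2) ^ j * t / n) := by gcongr
      _ = 16 * t * 2 ^ j * ((1 / 2 : ℝ) ^ j * 2 ^ j) := by rw [e1]; field_simp
      _ = _ := by rw [e2, mul_one]
  have hcoef : (0 : ℝ) ≤ 4 ^ g / n * (s * t) := by positivity
  have h4 : l * e ≤ l * (4 ^ g / n * (s * t) * (1 + r * Y)) + K * (t * L) := by
    have := mul_le_mul_of_nonneg_left hexp hcoef
    nlinarith [this]
  have hKL : K * (t * L) = l * (4 * K * t * (3 / 2) ^ j) := by
    have : r * (3 / 2) ^ j = 1 := by rw [hr, ← mul_pow]; norm_num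
    calc K * (t * L) = K * (t * L) * (r * (3 / 2) ^ j) := by rw [this, mul_one]
      _ = _ := by rw [hl]; ring
  have h5 : e ≤ 4 ^ g / n * (s * t) * (1 + r * Y) + 4 * K * t * (3 / 2) ^ j := by
    rw [hKL, ← mul_add] at h4
    exact le_of_mul_le_mul_left h4 hl0
  have e3 : (1 / 2 : ℝ) ^ j * (3 / 2) ^ j = (3 / 4) ^ j := by rw [← mul_pow]; norm_num
  have e4 : (2 : ℝ) ^ j * r = (4 / 3) ^ j := by rw [hr, ← mul_pow]; norm_num
  calc (4 : ℝ) ^ b * (1 / 2) ^ j * e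
      ≤ 4 ^ b * (1 / 2) ^ j * (4 ^ g / n * (s * t) * (1 + r * Y) + 4 * K * t * (3 / 2) ^ j) := by
        gcongr
    _ = 4 ^ b * (1 / 2) ^ j * (4 ^ g / n * (s * t)) * (1 + r * Y)
        + 4 * K * (4 ^ b * t) * ((1 / 2) ^ j * (3 / 2) ^ j) := by ring
    _ ≤ 16 * t * 2 ^ j * (1 + r * Y) + 4 * K * (4 ^ b * t) * ((1 / 2) ^ j * (3 / 2) ^ j) := by
        gcongr
    _ = 16 * t * 2 ^ j + 16 * (2 ^ j * r) * (t * Y)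
        + 4 * K * (4 ^ b * t) * ((1 / 2) ^ j * (3 / 2) ^ j) := by ring
    _ ≤ 16 * t * 2 ^ j + 16 * (2 ^ j * r) * (8 * n * (1 / 2) ^ b)
        + 4 * K * (4 ^ b * t) * ((1 / 2) ^ j * (3 / 2) ^ j) := by gcongr
    _ = _ := by rw [e3, e4]; ring

lemma geom_sum_le_of_lt_one {r C : ℝ} (hr0 : 0 ≤ r) (hr : r < 1) (hC : (1 - r)⁻¹ ≤ C) (m : ℕ) :
    ∑ j ∈ Finset.range m, r ^ j ≤ C :=
  ((summable_geometric_of_lt_one hr0 hr).sum_le_tsum _ fun _ _ => by positivity).trans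
    ((tsum_geometric_of_lt_one hr0 hr).trans_le hC)

/-- The index set of the relative scales of the blocks at level `b`. -/
def scales (g b : ℕ) : Finset ℕ := (Finset.range (g + 1)).filter (· ≤ 2 * b + 1)

/-- The three terms of `block_bound` are summed over `j ≤ 2 b + 1`, then over `b`. The ratio `2/3`
in `tilt` works because it lies between `1/2` and `1/√2`: the entropy term then decays like
`(3/4)^j`, while the growth `(4/3)^j` up to `j = 2 b + 1` costs `(16/9)^b`, which `(1/2)^b` beats.
-/
lemma sum_blocks_le {A : Matrix (Fin n) (Fin n) ℝ} {K : ℝ} {g : ℕ} (hn : 0 < n) (hK : 0 ≤ K)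
    (hdisc : Discrepancy A (4 ^ g) K) (w : Fin n → ℕ) (hw : ∑ i, (w i : ℝ) ^ 2 ≤ 16 * n) (B : ℕ) :
    ∑ b ∈ Finset.range B, ∑ j ∈ scales g b, 4 ^ b * (1 / 2) ^ j *
      blockSum A (superlevel w (b + g - j)) (superlevel w b) ≤ (512 * K + 8192) * n := by
  have hn' : (0 : ℝ) < n := by exact_mod_cast hn
  have hone : ∀ b, ∑ j ∈ scales g b, 4 ^ b * (1 / 2) ^ j *
      blockSum A (superlevel w (b + g - j)) (superlevel w b) ≤
      (16 * K + 64) * (4 ^ b * (superlevel w b).card) + 128 * n * (16 / 3) * (8 / 9) ^ b := by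
    intro b
    rcases (superlevel w b).eq_empty_or_nonempty with h0 | hne
    · have : ∀ S, blockSum A S ∅ = 0 := fun S => by simp [blockSum]
      simp only [h0, this]
      simp
      positivity
    set t : ℝ := ((superlevel w b).card : ℝ) with ht
    have ht1 : 1 ≤ t := by rw [ht]; exact_mod_cast hne.card_pos
    have htn : t ≤ n := by
      rw [ht]; exact_mod_cast (Finset.card_le_univ _).trans_eq (Fintype.card_fin n)
    have ht4 : t * 4 ^ b ≤ 16 * n := (card_superlevel_mul_le w b).trans hw
    have hterm : ∀ j ∈ scales g b, 4 ^ b * (1 / 2) ^ j *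
        blockSum A (superlevel w (b + g - j)) (superlevel w b) ≤
        4 * K * (4 ^ b * t) * (3 / 4) ^ j + 16 * t * 2 ^ j
          + 128 * n * (1 / 2) ^ b * (4 / 3) ^ j := by
      intro j hj
      simp only [scales, Finset.mem_filter, Finset.mem_range] at hj
      -- A nonempty superlevel set forces `4 ^ b ≤ 16 n`, so `2 ^ j ≤ 32 n`. Hence finitely many
      -- tilts suffice in `Discrepancy`.
      have hjn : j < 32 * n := by
        have h1 : (2 : ℝ) ^ j ≤ 32 * n := by
          calc (2 : ℝ) ^ j ≤ 2 ^ (2 * b + 1) := pow_le_pow_right₀ one_le_two hj.2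
            _ = 2 * 4 ^ b := by rw [pow_succ, pow_mul]; norm_num; ring
            _ ≤ 2 * (t * 4 ^ b) := by
              have : (0 : ℝ) < 4 ^ b := by positivity
              nlinarith
            _ ≤ 32 * n := by linarith
        have h2 : 2 ^ j ≤ 32 * n := by exact_mod_cast h1
        exact Nat.lt_two_pow_self.trans_le h2
      refine block_bound hn (Nat.cast_nonneg (superlevel w (b + g - j)).card) ht1 htn ?_ ht4 rfl
        (hdisc _ hne _ (superlevel_anti w (by omega)) j hjn)
      calc ((superlevel w (b + g - j)).card : ℝ) * 4 ^ (b + g)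
          = ((superlevel w (b + g - j)).card : ℝ) * 4 ^ (b + g - j) * 4 ^ j := by
            rw [mul_assoc, ← pow_add]; congr 2; omega
        _ ≤ _ := mul_le_mul_of_nonneg_right ((card_superlevel_mul_le w _).trans hw)
            (by positivity)
    have hsub : scales g b ⊆ Finset.range (2 * b + 2) := fun j hj => by
      simp only [scales, Finset.mem_filter, Finset.mem_range] at hj ⊢; omega
    calc _ ≤ ∑ j ∈ scales g b, (4 * K * (4 ^ b * t) * (3 / 4) ^ j + 16 * t * 2 ^ j
          + 128 * n * (1 / 2) ^ b * (4 / 3) ^ j) := Finset.sum_le_sum hterm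
      _ ≤ ∑ j ∈ Finset.range (2 * b + 2), (4 * K * (4 ^ b * t) * (3 / 4) ^ j + 16 * t * 2 ^ j
          + 128 * n * (1 / 2) ^ b * (4 / 3) ^ j) :=
          Finset.sum_le_sum_of_subset_of_nonneg hsub fun _ _ _ => by positivity
      _ = 4 * K * (4 ^ b * t) * (∑ j ∈ Finset.range (2 * b + 2), (3 / 4) ^ j)
          + 16 * t * (∑ j ∈ Finset.range (2 * b + 2), 2 ^ j)
          + 128 * n * (1 / 2) ^ b * (∑ j ∈ Finset.range (2 * b + 2), (4 / 3) ^ j) := by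
          simp only [Finset.sum_add_distrib, Finset.mul_sum]
      _ ≤ 4 * K * (4 ^ b * t) * 4 + 16 * t * (4 * 4 ^ b)
          + 128 * n * (1 / 2) ^ b * ((16 / 3) * (16 / 9) ^ b) := by
          gcongr
          · exact geom_sum_le_of_lt_one (by norm_num) (by norm_num) (by norm_num) _
          · rw [geom_sum_eq (by norm_num), pow_add, pow_mul]; norm_num; linarith
          · rw [geom_sum_eq (by norm_num), pow_add, pow_mul]; norm_num; linarith
      _ = (16 * K + 64) * (4 ^ b * t) + 128 * n * (16 / 3) * ((1 / 2) ^ b * (16 / 9) ^ b) := by ring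
      _ = _ := by rw [← mul_pow]; norm_num
  calc _ ≤ ∑ b ∈ Finset.range B, ((16 * K + 64) * (4 ^ b * ((superlevel w b).card : ℝ))
        + 128 * n * (16 / 3) * (8 / 9) ^ b) := Finset.sum_le_sum fun b _ => hone b
    _ = (16 * K + 64) * (∑ b ∈ Finset.range B, 4 ^ b * ((superlevel w b).card : ℝ))
        + 128 * n * (16 / 3) * ∑ b ∈ Finset.range B, (8 / 9) ^ b := by
        simp only [Finset.sum_add_distrib, Finset.mul_sum]
    _ ≤ (16 * K + 64) * (2 * (16 * n)) + 128 * n * (16 / 3) * 9 := by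
        gcongr
        · exact (sum_card_superlevel_le w B).trans (by gcongr)
        · exact geom_sum_le_of_lt_one (by norm_num) (by norm_num) (by norm_num) _
    _ ≤ _ := by linarith

/-- If `u ≥ 2^g v`, the product is at most `u² / 2^g`, later controlled by row sums. Otherwise let
`a`, `b` be the binary logarithms of `u`, `v`. Then `j = b + g - a` lies in `[0, g]`, and `u v >
2^g` gives `j ≤ 2 b + 1`. The single summand `(b, j)` already dominates, since `u v ≤ 2^(a+1)
2^(b+1)`. -/
lemma heavy_entry_le {g B u v : ℕ} (huv : 2 ^ g < u * v) (hvu : v ≤ u) (hB : v < 2 ^ B) :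
    (u : ℝ) * v ≤ (u : ℝ) ^ 2 / 2 ^ g + ∑ b ∈ Finset.range B, ∑ j ∈ scales g b,
      4 * 2 ^ g * (4 ^ b * (1 / 2) ^ j) *
        ((if 2 ^ (b + g - j) ≤ u then 1 else 0) * if 2 ^ b ≤ v then 1 else 0) := by
  have hv : v ≠ 0 := by rintro rfl; simp at huv
  have hu : u ≠ 0 := by rintro rfl; simp at huv
  rcases le_or_gt (2 ^ g * v) u with h | h
  · have h' : (2 : ℝ) ^ g * v ≤ u := by exact_mod_cast h
    have : (u : ℝ) * v ≤ (u : ℝ) ^ 2 / 2 ^ g := by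
      rw [le_div_iff₀ (by positivity)]
      nlinarith [(Nat.cast_nonneg u : (0 : ℝ) ≤ u)]
    refine this.trans (le_add_of_nonneg_right ?_)
    exact Finset.sum_nonneg fun b _ => Finset.sum_nonneg fun j _ => by positivity
  · set b := Nat.log 2 v with hb
    set a := Nat.log 2 u with ha
    have hb1 : 2 ^ b ≤ v := Nat.pow_log_le_self 2 hv
    have hb2 : v < 2 ^ (b + 1) := Nat.lt_pow_succ_log_self one_lt_two v
    have ha1 : 2 ^ a ≤ u := Nat.pow_log_le_self 2 hu
    have ha2 : u < 2 ^ (a + 1) := Nat.lt_pow_succ_log_self one_lt_two u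
    have hba : b ≤ a := Nat.log_mono_right hvu
    have hag : a < g + (b + 1) := by
      refine (Nat.pow_lt_pow_iff_right one_lt_two).1 (ha1.trans_lt (h.trans ?_))
      rw [pow_add]; exact Nat.mul_lt_mul_of_pos_left hb2 (by positivity)
    have hgab : g < (a + 1) + (b + 1) := by
      refine (Nat.pow_lt_pow_iff_right one_lt_two).1 (huv.trans_le ?_)
      rw [pow_add]; exact Nat.mul_le_mul ha2.le hb2.le
    have hbB : b < B := (Nat.pow_lt_pow_iff_right one_lt_two).1 (hb1.trans_lt hB)
    obtain ⟨j, hj⟩ : ∃ j, a + j = b + g := ⟨b + g - a, by omega⟩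
    have hjs : j ∈ scales g b := by
      simp only [scales, Finset.mem_filter, Finset.mem_range]; omega
    have hva : b + g - j = a := by omega
    have hmain : (u : ℝ) * v ≤ 4 * 2 ^ g * (4 ^ b * (1 / 2) ^ j) := by
      have e1 : (4 : ℝ) * 2 ^ g * (4 ^ b * (1 / 2) ^ j) = 2 ^ (a + 1) * 2 ^ (b + 1) := by
        have : (2 : ℝ) ^ a * 2 ^ j = 2 ^ b * 2 ^ g := by rw [← pow_add, ← pow_add, hj]
        have e2 : (4 : ℝ) ^ b = 2 ^ b * 2 ^ b := by rw [← mul_pow]; norm_num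
        have e3 : (2 : ℝ) ^ j * (1 / 2) ^ j = 1 := by rw [← mul_pow]; norm_num
        calc (4 : ℝ) * 2 ^ g * (4 ^ b * (1 / 2) ^ j)
            = 4 * 2 ^ b * (2 ^ b * 2 ^ g) * (1 / 2) ^ j := by rw [e2]; ring
          _ = 4 * 2 ^ b * 2 ^ a * (2 ^ j * (1 / 2) ^ j) := by rw [← this]; ring
          _ = _ := by rw [e3]; ring
      rw [e1]
      have h1 : (u : ℝ) ≤ 2 ^ (a + 1) := by exact_mod_cast ha2.le
      have h2 : (v : ℝ) ≤ 2 ^ (b + 1) := by exact_mod_cast hb2.le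
      gcongr
    have hnn : ∀ b' j' : ℕ, (0 : ℝ) ≤ 4 * 2 ^ g * (4 ^ b' * (1 / 2) ^ j') *
        ((if 2 ^ (b' + g - j') ≤ u then 1 else 0) * if 2 ^ b' ≤ v then 1 else 0) :=
      fun _ _ => by positivity
    have h1 : 4 * 2 ^ g * (4 ^ b * (1 / 2) ^ j) ≤ ∑ j' ∈ scales g b,
        4 * 2 ^ g * (4 ^ b * (1 / 2) ^ j') *
        ((if 2 ^ (b + g - j') ≤ u then (1 : ℝ) else 0) * if 2 ^ b ≤ v then 1 else 0) := by
      refine le_trans (le_of_eq ?_) (Finset.single_le_sum (fun j' _ => hnn b j') hjs)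
      rw [hva, if_pos ha1, if_pos hb1, mul_one, mul_one]
    have h2 := Finset.single_le_sum (f := fun b' => ∑ j' ∈ scales g b',
        4 * 2 ^ g * (4 ^ b' * (1 / 2) ^ j') *
        ((if 2 ^ (b' + g - j') ≤ u then (1 : ℝ) else 0) * if 2 ^ b' ≤ v then 1 else 0))
        (fun b' _ => Finset.sum_nonneg fun j' _ => hnn b' j') (Finset.mem_range.2 hbB)
    have h3 : (0 : ℝ) ≤ (u : ℝ) ^ 2 / 2 ^ g := by positivity
    linarith

/-- In a symmetric nonnegative matrix with bounded row sums and the discrepancy property, the heavy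
pairs contribute little to the quadratic form. -/
theorem heavy_pairs_le {A : Matrix (Fin n) (Fin n) ℝ} {K C : ℝ} {g : ℕ} (hn : 0 < n) (hK : 0 ≤ K)
    (hA : ∀ i j, 0 ≤ A i j) (hs : ∀ i j, A i j = A j i) (hdeg : ∀ i, ∑ j, A i j ≤ C * 4 ^ g)
    (hdisc : Discrepancy A (4 ^ g) K) (w : Fin n → ℕ) (hw : ∑ i, (w i : ℝ) ^ 2 ≤ 16 * n) :
    ∑ i, ∑ j, (if 2 ^ g < w i * w j then (w i : ℝ) * w j * A i j else 0) ≤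
      (32 * C + 8 * (512 * K + 8192)) * (n * 2 ^ g) := by
  obtain ⟨B, hB⟩ : ∃ B, ∀ i, w i < 2 ^ B :=
    ⟨∑ i, w i, fun i => (Finset.single_le_sum (fun _ _ => Nat.zero_le _)
      (Finset.mem_univ i)).trans_lt Nat.lt_two_pow_self⟩
  set f : Fin n → Fin n → ℝ := fun i j =>
    if 2 ^ g < w i * w j ∧ w j ≤ w i then (w i : ℝ) * w j * A i j else 0 with hf
  have hsplit : ∑ i, ∑ j, (if 2 ^ g < w i * w j then (w i : ℝ) * w j * A i j else 0) ≤
      2 * ∑ i, ∑ j, f i j := by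
    have h1 : ∑ i, ∑ j, f j i = ∑ i, ∑ j, f i j := Finset.sum_comm
    rw [two_mul]
    nth_rw 2 [← h1]
    simp only [← Finset.sum_add_distrib]
    refine Finset.sum_le_sum fun i _ => Finset.sum_le_sum fun j _ => ?_
    simp only [hf]
    have hnn : 0 ≤ (w i : ℝ) * w j * A i j := mul_nonneg (by positivity) (hA i j)
    have hsw : (w j : ℝ) * w i * A j i = (w i : ℝ) * w j * A i j := by rw [hs j i]; ring
    rw [hsw, mul_comm (w j) (w i)]
    by_cases h : 2 ^ g < w i * w j
    · rcases le_total (w i) (w j) with h' | h' <;> simp only [h, h', true_and, if_true] <;>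
        split_ifs <;> linarith
    · simp [h]
  have hpt : ∀ i j, f i j ≤ (w i : ℝ) ^ 2 / 2 ^ g * A i j + ∑ b ∈ Finset.range B,
      ∑ k ∈ scales g b, 4 * 2 ^ g * (4 ^ b * (1 / 2) ^ k) *
        ((if i ∈ superlevel w (b + g - k) then 1 else 0) *
          (if j ∈ superlevel w b then 1 else 0) * A i j) := by
    intro i j
    simp only [hf]
    split_ifs with h
    · have := mul_le_mul_of_nonneg_right (heavy_entry_le h.1 h.2 (hB j)) (hA i j)
      refine this.trans_eq ?_
      rw [add_mul, Finset.sum_mul]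
      congr 1
      refine Finset.sum_congr rfl fun b _ => ?_
      rw [Finset.sum_mul]
      refine Finset.sum_congr rfl fun k _ => ?_
      simp only [superlevel, Finset.mem_filter, Finset.mem_univ, true_and]
      ring
    · have h1 := hA i j
      refine add_nonneg (by positivity) ?_
      exact Finset.sum_nonneg fun b _ => Finset.sum_nonneg fun k _ => by positivity
  have hblock : ∀ S T : Finset (Fin n), ∑ i, ∑ j, ((if i ∈ S then 1 else 0) *
      (if j ∈ T then 1 else 0) * A i j) = blockSum A S T := fun S T => by
    calc _ = ∑ i, if i ∈ S then ∑ j, (if j ∈ T then A i j else 0) else 0 :=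
          Finset.sum_congr rfl fun i _ => by split_ifs <;> simp
      _ = _ := by simp [blockSum, Finset.sum_ite_mem]
  have hsum : ∑ i, ∑ j, f i j ≤ 16 * n * C * 2 ^ g +
      4 * 2 ^ g * ((512 * K + 8192) * n) := by
    calc ∑ i, ∑ j, f i j ≤ ∑ i, ∑ j, ((w i : ℝ) ^ 2 / 2 ^ g * A i j + ∑ b ∈ Finset.range B,
          ∑ k ∈ scales g b, 4 * 2 ^ g * (4 ^ b * (1 / 2) ^ k) *
          ((if i ∈ superlevel w (b + g - k) then 1 else 0) *
          (if j ∈ superlevel w b then 1 else 0) * A i j)) :=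
          Finset.sum_le_sum fun i _ => Finset.sum_le_sum fun j _ => hpt i j
      _ = ∑ i, (w i : ℝ) ^ 2 / 2 ^ g * ∑ j, A i j + 4 * 2 ^ g * ∑ b ∈ Finset.range B,
          ∑ k ∈ scales g b, 4 ^ b * (1 / 2) ^ k *
            blockSum A (superlevel w (b + g - k)) (superlevel w b) := by
          simp only [Finset.sum_add_distrib, ← hblock]
          congr 1
          · simp only [Finset.mul_sum]
          · simp only [Finset.mul_sum]
            rw [Finset.sum_congr rfl fun i _ => Finset.sum_comm, Finset.sum_comm]
            refine Finset.sum_congr rfl fun b _ => ?_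
            rw [Finset.sum_congr rfl fun i _ => Finset.sum_comm, Finset.sum_comm]
            refine Finset.sum_congr rfl fun k _ => ?_
            refine Finset.sum_congr rfl fun i _ => Finset.sum_congr rfl fun j _ => ?_
            ring
      _ ≤ ∑ i, (w i : ℝ) ^ 2 / 2 ^ g * (C * 4 ^ g) + 4 * 2 ^ g * ((512 * K + 8192) * n) := by
          gcongr with i
          · exact hdeg i
          · exact sum_blocks_le hn hK hdisc w hw B
      _ = (∑ i, (w i : ℝ) ^ 2) * (C * 2 ^ g) + 4 * 2 ^ g * ((512 * K + 8192) * n) := by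
          rw [Finset.sum_mul]
          congr 1
          refine Finset.sum_congr rfl fun i _ => ?_
          rw [show (4 : ℝ) ^ g = 2 ^ g * 2 ^ g by rw [← mul_pow]; norm_num]
          field_simp
      _ ≤ _ := by
          have hC : 0 ≤ C * 2 ^ g := by
            have h0 := (Finset.sum_nonneg fun j _ => hA ⟨0, hn⟩ j).trans (hdeg ⟨0, hn⟩)
            have : 0 ≤ C := nonneg_of_mul_nonneg_left h0 (by positivity)
            positivity
          have := mul_le_mul_of_nonneg_right hw hC
          linarith
  calc _ ≤ _ := hsplit
    _ ≤ 2 * (16 * n * C * 2 ^ g + 4 * 2 ^ g * ((512 * K + 8192) * n)) := by gcongr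
    _ = _ := by ring

end HeavyPairs

/-! ### From integer points to the whole quadratic form. -/

section Rounding

variable {n : ℕ}

/-- The quadratic form `xᵀ A x`. -/
def quadForm (A : Matrix (Fin n) (Fin n) ℝ) (x : Fin n → ℝ) : ℝ := ∑ i, ∑ j, A i j * (x i * x j)

lemma quadForm_smul (A : Matrix (Fin n) (Fin n) ℝ) (c : ℝ) (x : Fin n → ℝ) :
    quadForm A (fun i => c * x i) = c ^ 2 * quadForm A x := by
  simp only [quadForm, Finset.mul_sum]
  exact Finset.sum_congr rfl fun i _ => Finset.sum_congr rfl fun j _ => by ring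

/-- The two new vectors are `(x + y)/4 ± (x - y)`, so this is polarization and needs no symmetry of
`A`. The weight `1/4` on the long vector `x + y` balances it against the short vector `x - y`. -/
lemma quadForm_sub (A : Matrix (Fin n) (Fin n) ℝ) (x y : Fin n → ℝ) :
    quadForm A x - quadForm A y = quadForm A (fun i => (5 * x i - 3 * y i) / 4) -
      quadForm A (fun i => (5 * y i - 3 * x i) / 4) := by
  simp only [quadForm, ← Finset.sum_sub_distrib]
  exact Finset.sum_congr rfl fun i _ => Finset.sum_congr rfl fun j _ => by ring

/-- Rounding is towards zero, so that the norm does not grow and the rounded vector stays in the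
ball. -/
lemma exists_int_round (a : ℝ) : ∃ z : ℤ, (z : ℝ) ^ 2 ≤ a ^ 2 ∧ (a - z) ^ 2 ≤ 1 := by
  rcases le_total 0 a with h | h
  · refine ⟨⌊a⌋, ?_, ?_⟩
    · have h1 : (0 : ℝ) ≤ ⌊a⌋ := by exact_mod_cast Int.floor_nonneg.2 h
      exact pow_le_pow_left₀ h1 (Int.floor_le a) 2
    · have h1 := Int.floor_le a
      have h2 := Int.lt_floor_add_one a
      nlinarith
  · refine ⟨⌈a⌉, ?_, ?_⟩
    · have h1 : (⌈a⌉ : ℝ) ≤ 0 := by exact_mod_cast Int.ceil_le.2 (by simpa using h)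
      have h2 := Int.le_ceil a
      nlinarith
    · have h1 := Int.le_ceil a
      have h2 := Int.ceil_lt_add_one a
      nlinarith

/-- A quadratic form that is small on the integer points of a ball of radius `4 √n` is small
everywhere. -/
theorem quadForm_le_of_int {A : Matrix (Fin n) (Fin n) ℝ} {c : ℝ} (hn : 0 < n)
    (h : ∀ z : Fin n → ℤ, ∑ i, (z i : ℝ) ^ 2 ≤ 16 * n →
      |quadForm A fun i => (z i : ℝ)| ≤ c * (16 * n)) (x : Fin n → ℝ) :
    |quadForm A x| ≤ 3 * c * ∑ i, x i ^ 2 := by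
  have hn' : (0 : ℝ) < n := by exact_mod_cast hn
  have hc : 0 ≤ c := by
    have := (abs_nonneg _).trans (h 0 (by simp))
    exact nonneg_of_mul_nonneg_left this (by positivity)
  set S : Set ℝ := (fun x => |quadForm A x|) '' {x : Fin n → ℝ | ∑ i, x i ^ 2 ≤ 1} with hS
  have hbdd : BddAbove S := by
    refine ⟨∑ i, ∑ j, |A i j|, ?_⟩
    rintro _ ⟨x, hx, rfl⟩
    have hx1 : ∀ i, |x i| ≤ 1 := fun i => by
      rw [← sq_le_one_iff_abs_le_one]
      exact (Finset.single_le_sum (f := fun i => x i ^ 2) (fun _ _ => sq_nonneg _)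
        (Finset.mem_univ i)).trans hx
    refine (Finset.abs_sum_le_sum_abs _ _).trans (Finset.sum_le_sum fun i _ => ?_)
    refine (Finset.abs_sum_le_sum_abs _ _).trans (Finset.sum_le_sum fun j _ => ?_)
    rw [abs_mul, abs_mul]
    exact mul_le_of_le_one_right (abs_nonneg _) (mul_le_one₀ (hx1 i) (abs_nonneg _) (hx1 j))
  set M := sSup S with hM
  have hle1 : ∀ x : Fin n → ℝ, ∑ i, x i ^ 2 ≤ 1 → |quadForm A x| ≤ M := fun x hx =>
    le_csSup hbdd ⟨x, hx, rfl⟩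
  have hM0 : 0 ≤ M := (abs_nonneg _).trans (hle1 0 (by simp))
  have hle : ∀ x : Fin n → ℝ, |quadForm A x| ≤ M * ∑ i, x i ^ 2 := by
    intro x
    set r := ∑ i, x i ^ 2 with hr
    have hr0 : 0 ≤ r := Finset.sum_nonneg fun _ _ => sq_nonneg _
    rcases hr0.eq_or_lt with h0 | h0
    · have hx : x = fun i => 0 * x i := by
        funext i
        have := (Finset.sum_eq_zero_iff_of_nonneg fun i _ => sq_nonneg (x i)).1 h0.symm i
          (Finset.mem_univ i)
        rw [zero_mul]
        exact pow_eq_zero_iff two_ne_zero |>.1 this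
      rw [hx, quadForm_smul, ← h0]
      simp
    · have h1 := hle1 (fun i => (Real.sqrt r)⁻¹ * x i) (by
        simp only [mul_pow, ← Finset.mul_sum]
        rw [← hr, inv_pow, Real.sq_sqrt hr0, inv_mul_cancel₀ h0.ne'])
      rw [quadForm_smul, inv_pow, Real.sq_sqrt hr0, abs_mul, abs_of_pos (by positivity),
        inv_mul_le_iff₀ h0] at h1
      linarith
  -- Bootstrap: the difference to the rounded point costs `M` times `‖x + y‖²/8 + 2‖x - y‖² ≤ 1/2 +
  -- 1/8`. Since `5/8 < 1`, this gives `M ≤ 8c/3 ≤ 3c`.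
  have hkey : ∀ x : Fin n → ℝ, ∑ i, x i ^ 2 ≤ 1 → |quadForm A x| ≤ c + 5 / 8 * M := by
    intro x hx
    set k := 4 * Real.sqrt n with hk
    have hk0 : 0 < k := by positivity
    have hk2 : k ^ 2 = 16 * n := by rw [hk, mul_pow, Real.sq_sqrt hn'.le]; norm_num
    choose z hz1 hz2 using fun i => exists_int_round (k * x i)
    set y : Fin n → ℝ := fun i => k⁻¹ * z i with hy
    have hky : ∀ i, (z i : ℝ) = k * y i := fun i => by simp only [hy]; field_simp
    have hy1 : ∑ i, y i ^ 2 ≤ 1 := by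
      refine le_trans (Finset.sum_le_sum fun i _ => ?_) hx
      have := hz1 i
      rw [hky, mul_pow k (y i), mul_pow k (x i)] at this
      exact le_of_mul_le_mul_left this (by positivity)
    have hxy : ∑ i, (x i - y i) ^ 2 ≤ 1 / 16 := by
      have h1 : ∀ i, (x i - y i) ^ 2 ≤ 1 / (16 * n) := fun i => by
        have := hz2 i
        rw [hky, ← mul_sub, mul_pow, hk2] at this
        rw [le_div_iff₀ (by positivity)]
        linarith
      refine (Finset.sum_le_sum fun i _ => h1 i).trans_eq ?_
      rw [Finset.sum_const, Finset.card_univ, Fintype.card_fin, nsmul_eq_mul]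
      field_simp
    have hQy : |quadForm A y| ≤ c := by
      rw [hy, quadForm_smul, inv_pow, hk2, abs_mul, abs_of_pos (by positivity),
        inv_mul_le_iff₀ (by positivity), mul_comm]
      refine h z ?_
      simp only [hky, mul_pow, ← Finset.mul_sum]
      rw [hk2]
      exact mul_le_of_le_one_right (by positivity) hy1
    have hnorm : ∑ i, ((5 * x i - 3 * y i) / 4) ^ 2 + ∑ i, ((5 * y i - 3 * x i) / 4) ^ 2 ≤
        5 / 8 := by
      have e : ∑ i, ((5 * x i - 3 * y i) / 4) ^ 2 + ∑ i, ((5 * y i - 3 * x i) / 4) ^ 2 ≤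
          2 * ∑ i, (x i - y i) ^ 2 + 1 / 4 * ∑ i, x i ^ 2 + 1 / 4 * ∑ i, y i ^ 2 := by
        simp only [Finset.mul_sum, ← Finset.sum_add_distrib]
        refine Finset.sum_le_sum fun i _ => ?_
        nlinarith [sq_nonneg (x i - y i)]
      linarith
    have h1 := hle fun i => (5 * x i - 3 * y i) / 4
    have h2 := hle fun i => (5 * y i - 3 * x i) / 4
    have h3 := mul_le_mul_of_nonneg_left hnorm hM0
    have h4 := quadForm_sub A x y
    rw [abs_le] at h1 h2 hQy ⊢
    constructor <;> linarith [h1.1, h1.2, h2.1, h2.2, hQy.1, hQy.2]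
  have hMle : M ≤ c + 5 / 8 * M :=
    csSup_le ⟨_, 0, by simp, rfl⟩ (by rintro _ ⟨x, hx, rfl⟩; exact hkey x hx)
  exact (hle x).trans (mul_le_mul_of_nonneg_right (by linarith)
    (Finset.sum_nonneg fun _ _ => sq_nonneg _))

end Rounding

/-! ### Cardinalities for the union bounds. -/

section Counting

lemma sum_exp_neg_sq_le (m : ℕ) :
    ∑ k ∈ Finset.Icc (-(m : ℤ)) m, Real.exp (-(k : ℝ) ^ 2) ≤ Real.exp 2 := by
  have hhalf : Real.exp (-1) ≤ 1 / 2 := by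
    rw [Real.exp_neg, inv_le_comm₀ (Real.exp_pos _) (by norm_num)]
    linarith [Real.add_one_le_exp (1 : ℝ)]
  have hle : ∀ a : ℕ, Real.exp (-(a : ℝ) ^ 2) ≤ (1 / 2) ^ a := fun a => by
    have h1 : (a : ℝ) ≤ (a : ℝ) ^ 2 := by exact_mod_cast Nat.le_self_pow two_ne_zero a
    calc Real.exp (-(a : ℝ) ^ 2) ≤ Real.exp (a * (-1)) := Real.exp_le_exp.2 (by linarith)
      _ = Real.exp (-1) ^ a := Real.exp_nat_mul _ _
      _ ≤ _ := pow_le_pow_left₀ (Real.exp_pos _).le hhalf a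
  have hsub : Finset.Icc (-(m : ℤ)) m ⊆ (Finset.range (m + 1)).image (fun a : ℕ => (a : ℤ)) ∪
      (Finset.range (m + 1)).image (fun a : ℕ => -(a : ℤ)) := by
    intro k hk
    rw [Finset.mem_Icc] at hk
    simp only [Finset.mem_union, Finset.mem_image, Finset.mem_range]
    rcases le_total 0 k with h | h
    · exact Or.inl ⟨k.toNat, by omega, by omega⟩
    · exact Or.inr ⟨(-k).toNat, by omega, by omega⟩
  have hgeom : ∑ a ∈ Finset.range (m + 1), Real.exp (-(a : ℝ) ^ 2) ≤ 2 :=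
    (Finset.sum_le_sum fun a _ => hle a).trans
      (geom_sum_le_of_lt_one (by norm_num) (by norm_num) (by norm_num) _)
  have hexp : (4 : ℝ) ≤ Real.exp 2 := by
    have : Real.exp 2 = Real.exp 1 * Real.exp 1 := by rw [← Real.exp_add]; norm_num
    nlinarith [Real.add_one_le_exp (1 : ℝ)]
  have hnn : ∀ k : ℤ, 0 ≤ Real.exp (-(k : ℝ) ^ 2) := fun _ => (Real.exp_pos _).le
  calc _ ≤ _ := Finset.sum_le_sum_of_subset_of_nonneg hsub fun k _ _ => hnn k
    _ ≤ _ := Finset.sum_union_inter (f := fun k : ℤ => Real.exp (-(k : ℝ) ^ 2)) ▸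
        le_add_of_nonneg_right (Finset.sum_nonneg fun k _ => hnn k)
    _ ≤ 2 + 2 := by
        refine add_le_add ?_ ?_
        · rw [Finset.sum_image (by intro a _ b _; simp)]; simpa using hgeom
        · rw [Finset.sum_image (by intro a _ b _; simp)]; simpa using hgeom
    _ ≤ _ := by linarith

/-- The integer points in the ball of squared radius `16 n`. -/
def latticeBall (n : ℕ) : Finset (Fin n → ℤ) :=
  (Fintype.piFinset fun _ => Finset.Icc (-((16 * n : ℕ) : ℤ)) (16 * n : ℕ)).filter
    fun z => ∑ i, (z i : ℝ) ^ 2 ≤ 16 * n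

lemma mem_latticeBall {n : ℕ} {z : Fin n → ℤ} :
    z ∈ latticeBall n ↔ ∑ i, (z i : ℝ) ^ 2 ≤ 16 * n := by
  refine ⟨fun h => (Finset.mem_filter.1 h).2, fun h => Finset.mem_filter.2 ⟨?_, h⟩⟩
  rw [Fintype.mem_piFinset]
  intro i
  have h1 : (z i : ℝ) ^ 2 ≤ 16 * n := (Finset.single_le_sum (f := fun i => (z i : ℝ) ^ 2)
    (fun _ _ => sq_nonneg _) (Finset.mem_univ i)).trans h
  have h2 : (z i) ^ 2 ≤ ((16 * n : ℕ) : ℤ) := by exact_mod_cast h1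
  rw [Finset.mem_Icc]
  constructor <;> nlinarith [sq_nonneg (z i - 1), sq_nonneg (z i + 1), sq_nonneg (z i)]

/-- Exponential Markov for counting: `1 ≤ e^(16 n - ‖z‖²)` on the ball, and the sum of the right
side over a cube factors into coordinates, each contributing at most `e²`. -/
lemma card_latticeBall_le (n : ℕ) : ((latticeBall n).card : ℝ) ≤ Real.exp (18 * n) := by
  calc ((latticeBall n).card : ℝ) = ∑ z ∈ latticeBall n, (1 : ℝ) := by simp
    _ ≤ ∑ z ∈ latticeBall n, Real.exp (16 * n) * ∏ i, Real.exp (-(z i : ℝ) ^ 2) := by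
        refine Finset.sum_le_sum fun z hz => ?_
        rw [← Real.exp_sum, ← Real.exp_add, Finset.sum_neg_distrib]
        exact Real.one_le_exp (by linarith [mem_latticeBall.1 hz])
    _ ≤ ∑ z ∈ Fintype.piFinset fun _ : Fin n => Finset.Icc (-((16 * n : ℕ) : ℤ)) (16 * n : ℕ),
          Real.exp (16 * n) * ∏ i, Real.exp (-(z i : ℝ) ^ 2) :=
        Finset.sum_le_sum_of_subset_of_nonneg (Finset.filter_subset _ _) fun _ _ _ => by positivity
    _ = Real.exp (16 * n) * ∏ _i : Fin n, ∑ k ∈ Finset.Icc (-((16 * n : ℕ) : ℤ)) (16 * n : ℕ),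
          Real.exp (-(k : ℝ) ^ 2) := by
        rw [← Finset.mul_sum, Finset.prod_univ_sum]
    _ ≤ Real.exp (16 * n) * ∏ _i : Fin n, Real.exp 2 := by
        gcongr
        exact sum_exp_neg_sq_le _
    _ = _ := by
        rw [Finset.prod_const, Finset.card_univ, Fintype.card_fin, ← Real.exp_nat_mul,
          ← Real.exp_add]
        congr 1; ring

/-- Turns a multiple of the entropy exponent `t log (e n / t)` into a power of `n`, uniformly in the
set size `t`. -/
lemma log_le_mul_one_add_log {n t : ℕ} (ht : 0 < t) (htn : t ≤ n) :
    Real.log n ≤ t * (1 + Real.log (n / t)) := by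
  have hn' : (0 : ℝ) < n := by exact_mod_cast ht.trans_le htn
  have ht' : (1 : ℝ) ≤ t := by exact_mod_cast ht
  have ht0 : (0 : ℝ) < t := by linarith
  have h0 : 0 ≤ Real.log (n / t) := Real.log_nonneg ((one_le_div ht0).2 (by exact_mod_cast htn))
  have h1 : Real.log n = Real.log (n / t) + Real.log t := by
    rw [← Real.log_mul (by positivity) (by positivity), div_mul_cancel₀ _ ht0.ne']
  have h2 := Real.log_le_sub_one_of_pos ht0
  nlinarith

/-- A single term of the binomial expansion of `(1 + t/n)^n ≤ e^t`. -/
lemma choose_le_exp {n t : ℕ} (ht : 0 < t) (htn : t ≤ n) :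
    (n.choose t : ℝ) ≤ Real.exp (t * (1 + Real.log (n / t))) := by
  have ht0 : (0 : ℝ) < t := by exact_mod_cast ht
  have hn0 : (0 : ℝ) < n := by exact_mod_cast ht.trans_le htn
  have h1 : ((t : ℝ) / n) ^ t * n.choose t ≤ Real.exp t := by
    calc ((t : ℝ) / n) ^ t * n.choose t ≤ ∑ k ∈ Finset.range (n + 1),
          ((t : ℝ) / n) ^ k * 1 ^ (n - k) * n.choose k := by
          have := Finset.single_le_sum (f := fun k => ((t : ℝ) / n) ^ k * 1 ^ (n - k) * n.choose k)
            (fun k _ => by positivity) (Finset.mem_range.2 (Nat.lt_succ_of_le htn))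
          simpa using this
      _ = ((t : ℝ) / n + 1) ^ n := (add_pow _ _ _).symm
      _ ≤ Real.exp (t / n) ^ n := pow_le_pow_left₀ (by positivity) (Real.add_one_le_exp _) n
      _ = Real.exp t := by rw [← Real.exp_nat_mul]; congr 1; field_simp
  have h2 : Real.exp (t * Real.log (n / t)) = ((t : ℝ) / n)⁻¹ ^ t := by
    rw [Real.exp_nat_mul, Real.exp_log (by positivity), inv_div]
  rw [mul_add, mul_one, Real.exp_add, h2, inv_pow, ← div_eq_mul_inv, le_div_iff₀ (by positivity)]
  linarith

end Counting

lemma exp_neg_mul_log {n : ℕ} (hn : 0 < n) (k : ℕ) : Real.exp (-(k * Real.log n)) = 1 / (n : ℝ) ^ k := by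
  have : (0 : ℝ) < n := by exact_mod_cast hn
  rw [Real.exp_neg, Real.exp_nat_mul, Real.exp_log this, one_div]

/-- Union bound over a finite set of indices. -/
lemma measureReal_exists_le {Ω : Type*} [MeasurableSpace Ω] {μ : Measure Ω} {ι : Type*} (s : Finset ι) (P : ι → Ω → Prop) {c : ℝ}
    (h : ∀ i ∈ s, μ.real {ω | P i ω} ≤ c) : μ.real {ω | ∃ i ∈ s, P i ω} ≤ s.card * c := by
  have hset : {ω | ∃ i ∈ s, P i ω} = ⋃ i ∈ s, {ω | P i ω} := by
    ext ω; simp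
  rw [hset]
  refine (measureReal_biUnion_finset_le _ _).trans ((Finset.sum_le_sum h).trans_eq ?_)
  rw [Finset.sum_const, nsmul_eq_mul]

lemma mean_similarity_le {n d g : ℕ} {p : ℝ} {m : Edge n d → ℝ} (hd : 2 ≤ d) (hn : 2 ≤ n)
    (hp : ∀ e, m e ≤ p) (hg : n * codegree n d * p ≤ 4 ^ g) (i j : Fin n) :
    similarityMatrix m i j ≤ 4 ^ g / n := by
  have hn0 : (0 : ℝ) < n := by positivity
  simp only [similarityMatrix, Matrix.of_apply]
  split_ifs with h
  · positivity
  · calc _ ≤ ∑ e ∈ Finset.univ.filter (fun e : Edge n d => i ∈ e.1 ∧ j ∈ e.1), p :=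
          Finset.sum_le_sum fun e _ => hp e
      _ = codegree n d * p := by
          rw [Finset.sum_const, card_edges_containing hd h, nsmul_eq_mul]
      _ ≤ _ := by rw [le_div_iff₀ hn0]; linarith

/-! ### The spectral bound: good events and their probabilities. -/

section Events

variable {n d : ℕ} {Ω : Type*} [MeasurableSpace Ω] {μ : Measure Ω}
  {W : Edge n d → Ω → ℝ} {p : ℝ} {g : ℕ}

/-- The part of `z zᵀ` with entries of size at most `2 ^ g`. -/
def lightPart (g : ℕ) (z : Fin n → ℤ) : Matrix (Fin n) (Fin n) ℝ :=
  Matrix.of fun i j => if 2 ^ g < (z i).natAbs * (z j).natAbs then 0 else (z i : ℝ) * z j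

/-- The constant in the spectral bound for the centered similarity matrix. -/
def spectralConst (d : ℕ) : ℝ :=
  3 * ((286 * (d : ℝ) ^ 2 + ((32 * (14 * (d : ℝ) ^ 2) + 8 * (512 * (20 * (d : ℝ) ^ 2) + 8192)) + 256))
    / 16)

lemma quadForm_deviation_le (hd : 2 ≤ d) (hn : 2 ≤ n)
    (hm0 : ∀ e, 0 ≤ ∫ ω, W e ω ∂μ) (hp : ∀ e, ∫ ω, W e ω ∂μ ≤ p)
    (hg : n * codegree n d * p ≤ 4 ^ g) {ω : Ω} (hW : ∀ e, 0 ≤ W e ω)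
    (hrow : ∀ i, ∑ j, similarityMatrix (fun e => W e ω) i j ≤ 14 * (d : ℝ) ^ 2 * 4 ^ g)
    (hdisc : Discrepancy (similarityMatrix fun e => W e ω) (4 ^ g) (20 * (d : ℝ) ^ 2))
    (hlight : ∀ z ∈ latticeBall n, |entryInner (deviation μ W ω) (lightPart g z)| ≤
      286 * (d : ℝ) ^ 2 * (n * 2 ^ g)) (x : Fin n → ℝ) :
    |quadForm (deviation μ W ω) x| ≤ spectralConst d * 2 ^ g * ∑ i, x i ^ 2 := by
  have hn0 : (0 : ℝ) < n := by positivity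
  set A := similarityMatrix (fun e => W e ω) with hA
  set E := similarityMatrix (fun e => ∫ ω, W e ω ∂μ) with hE
  have hD : deviation μ W ω = A - E := similarityMatrix_sub _ _
  have key := quadForm_le_of_int (A := deviation μ W ω)
    (c := (286 * (d : ℝ) ^ 2 + ((32 * (14 * (d : ℝ) ^ 2) + 8 * (512 * (20 * (d : ℝ) ^ 2) + 8192))
      + 256)) / 16 * 2 ^ g) (by omega) (fun z hz => ?_) x
  · refine key.trans_eq ?_
    rw [spectralConst]; ring
  set w : Fin n → ℕ := fun i => (z i).natAbs with hw
  have hzabs : ∀ i, |(z i : ℝ)| = w i := fun i => by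
    rw [← Int.cast_abs, Int.abs_eq_natAbs]; rfl
  have hwsq : ∀ i, (w i : ℝ) ^ 2 = (z i : ℝ) ^ 2 := fun i => by rw [← hzabs, sq_abs]
  have hwle : ∑ i, (w i : ℝ) ^ 2 ≤ 16 * n := by simpa only [hwsq] using hz
  have hAnn := similarityMatrix_nonneg hW
  have hEnn := similarityMatrix_nonneg hm0
  have hheavyA := heavy_pairs_le (by omega) (by positivity) hAnn (similarityMatrix_symm _) hrow
    hdisc w hwle
  -- One factor `2 ^ g` of `4 ^ g` is traded for `w i * w j`, leaving `(∑ w²)² · 2^g / n`.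
  have hheavyE : ∑ i, ∑ j, (if 2 ^ g < w i * w j then (w i : ℝ) * w j * E i j else 0) ≤
      256 * (n * 2 ^ g) := by
    calc _ ≤ ∑ i, ∑ j, (w i : ℝ) ^ 2 * (w j : ℝ) ^ 2 * (2 ^ g / n) := by
          refine Finset.sum_le_sum fun i _ => Finset.sum_le_sum fun j _ => ?_
          split_ifs with h
          · have h1 : (2 : ℝ) ^ g ≤ w i * w j := by exact_mod_cast h.le
            have h2 := mean_similarity_le hd hn hp hg i j
            calc (w i : ℝ) * w j * E i j ≤ (w i : ℝ) * w j * (4 ^ g / n) := by gcongr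
              _ = (w i : ℝ) * w j * (2 ^ g * (2 ^ g / n)) := by
                rw [show (4 : ℝ) ^ g = 2 ^ g * 2 ^ g by rw [← mul_pow]; norm_num]; ring
              _ ≤ (w i : ℝ) * w j * ((w i * w j) * (2 ^ g / n)) := by gcongr
              _ = _ := by ring
          · positivity
      _ = (∑ i, (w i : ℝ) ^ 2) ^ 2 * (2 ^ g / n) := by
          rw [sq (∑ i, _), Finset.sum_mul_sum]
          simp only [Finset.sum_mul]
      _ ≤ (16 * n) ^ 2 * (2 ^ g / n) := by
          gcongr
      _ = _ := by field_simp; ring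
  have hsplit : quadForm (deviation μ W ω) (fun i => (z i : ℝ)) =
      entryInner (deviation μ W ω) (lightPart g z) + ∑ i, ∑ j,
        (if 2 ^ g < w i * w j then (z i : ℝ) * z j * (A i j - E i j) else 0) := by
    simp only [quadForm, entryInner, ← Finset.sum_add_distrib]
    refine Finset.sum_congr rfl fun i _ => Finset.sum_congr rfl fun j _ => ?_
    simp only [lightPart, Matrix.of_apply, hw, hD, Matrix.sub_apply]
    split_ifs <;> ring
  have hheavy : |∑ i, ∑ j, (if 2 ^ g < w i * w j then (z i : ℝ) * z j * (A i j - E i j) else 0)| ≤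
      ∑ i, ∑ j, (if 2 ^ g < w i * w j then (w i : ℝ) * w j * A i j else 0) +
      ∑ i, ∑ j, (if 2 ^ g < w i * w j then (w i : ℝ) * w j * E i j else 0) := by
    simp only [← Finset.sum_add_distrib]
    refine (Finset.abs_sum_le_sum_abs _ _).trans (Finset.sum_le_sum fun i _ => ?_)
    refine (Finset.abs_sum_le_sum_abs _ _).trans (Finset.sum_le_sum fun j _ => ?_)
    split_ifs
    · rw [abs_mul, abs_mul, hzabs, hzabs, ← mul_add]
      refine mul_le_mul_of_nonneg_left ?_ (by positivity)
      rw [abs_le]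
      constructor <;> linarith [hAnn i j, hEnn i j]
    · simp
  have hl := hlight z (mem_latticeBall.2 hz)
  rw [hsplit]
  refine (abs_add_le _ _).trans ?_
  linarith

variable [IsProbabilityMeasure μ]

/-- Chernoff with `l = 1`: of the constant 14, the mean uses `e - 1 ≤ 2`, and the remaining 12 gives
`n^(-12)` per row because `log n ≤ 4 ^ g`. -/
lemma rowSum_tail (hd : 2 ≤ d) (hn : 2 ≤ n) (hp0 : 0 ≤ p)
    (hm : ∀ e, Measurable (W e)) (hi : iIndepFun W μ)
    (hb : ∀ e, ∀ᵐ ω ∂μ, 0 ≤ W e ω ∧ W e ω ≤ 1) (hp : ∀ e, ∫ ω, W e ω ∂μ ≤ p)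
    (hg : n * codegree n d * p ≤ 4 ^ g) (hlog : Real.log n ≤ 4 ^ g) :
    μ.real {ω | ∃ i ∈ (Finset.univ : Finset (Fin n)),
      14 * (d : ℝ) ^ 2 * 4 ^ g ≤ ∑ j, similarityMatrix (fun e => W e ω) i j} ≤
      1 / (n : ℝ) ^ 11 := by
  have hn0 : (0 : ℝ) < n := by positivity
  have hd1 : (1 : ℝ) ≤ (d : ℝ) ^ 2 := by
    have : (1 : ℝ) ≤ d := by exact_mod_cast (by omega : 1 ≤ d)
    exact one_le_pow₀ this
  refine (measureReal_exists_le _ _ (c := 1 / (n : ℝ) ^ 12) fun i _ => ?_).trans_eq ?_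
  · set F : Matrix (Fin n) (Fin n) ℝ := Matrix.of fun i' _ => if i' = i then 1 else 0 with hF
    have h := entryInner_similarity_upper hd hp0 hm hi hb hp (F := F)
      (fun i' j => by simp only [hF, Matrix.of_apply]; split_ifs <;> simp) zero_le_one (14 * 4 ^ g)
    have hsum : ∑ i, ∑ j, F i j = n := by
      simp [hF]
    have hset : ∀ ω, entryInner (similarityMatrix fun e => W e ω) F =
        ∑ j, similarityMatrix (fun e => W e ω) i j := fun ω => by
      rw [entryInner, Finset.sum_eq_single i]
      · simp [hF]
      · intro b _ hb; simp [hF, hb]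
      · simp
    simp only [hset, one_mul, hsum] at h
    have e1 : (14 * (d : ℝ) ^ 2 * 4 ^ g) = (d : ℝ) ^ 2 * (14 * 4 ^ g) := by ring
    rw [e1]
    refine h.trans ?_
    rw [← exp_neg_mul_log (by omega) 12, Real.exp_le_exp]
    have h1 : p * (codegree n d * n) / (d : ℝ) ^ 2 ≤ 4 ^ g := by
      refine (div_le_self (by positivity) hd1).trans ?_
      linarith
    have h2 : Real.exp 1 - 1 ≤ 2 := by linarith [Real.exp_one_lt_d9]
    have h3 : p * (codegree n d * n) / (d : ℝ) ^ 2 * (Real.exp 1 - 1) ≤ 4 ^ g * 2 := by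
      gcongr
      linarith [Real.add_one_le_exp (1 : ℝ)]
    push_cast
    linarith
  · rw [Finset.card_univ, Fintype.card_fin]
    field_simp

/-- Each triple `(T, S, j)` fails with probability at most `e^(-20 L)`, where `L = t log (e n / t)`.
The `2^t` subsets `S` and the `C(n, t)` sets `T` use one `L` each. The remaining `18 L ≥ 18 log n`
absorbs the `32 n` tilts and the `n` sizes. -/
lemma discrepancy_tail (hd : 2 ≤ d) (hn : 2 ≤ n) (hp0 : 0 ≤ p)
    (hm : ∀ e, Measurable (W e)) (hi : iIndepFun W μ)
    (hb : ∀ e, ∀ᵐ ω ∂μ, 0 ≤ W e ω ∧ W e ω ≤ 1) (hp : ∀ e, ∫ ω, W e ω ∂μ ≤ p)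
    (hg : n * codegree n d * p ≤ 4 ^ g) :
    μ.real {ω | ¬ Discrepancy (similarityMatrix fun e => W e ω) (4 ^ g) (20 * (d : ℝ) ^ 2)} ≤
      1 / (n : ℝ) ^ 11 := by
  have hn0 : (0 : ℝ) < n := by positivity
  have hd0 : (0 : ℝ) < (d : ℝ) ^ 2 := by positivity
  have hpN : p * codegree n d ≤ 4 ^ g / n := by
    rw [le_div_iff₀ hn0]; linarith
  set L : ℕ → ℝ := fun t => t * (1 + Real.log (n / t)) with hL
  set P : Finset (Fin n) → Finset (Fin n) → ℕ → Ω → Prop := fun T S j ω =>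
    (d : ℝ) ^ 2 * (4 ^ g / n * (S.card * T.card) * (Real.exp (tilt n T.card j) - 1) / d ^ 2
      + 20 * L T.card) ≤ tilt n T.card j * blockSum (similarityMatrix fun e => W e ω) S T with hP
  have htilt : ∀ T : Finset (Fin n), T.Nonempty → ∀ j, 0 ≤ tilt n T.card j := fun T hT j => by
    have h1 : (0 : ℝ) < T.card := by exact_mod_cast hT.card_pos
    have h2 : (T.card : ℝ) ≤ n := by
      exact_mod_cast (Finset.card_le_univ T).trans_eq (Fintype.card_fin n)
    have := Real.log_nonneg ((one_le_div h1).2 h2)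
    unfold tilt
    positivity
  have hone : ∀ T : Finset (Fin n), T.Nonempty → ∀ S j, μ.real {ω | P T S j ω} ≤
      Real.exp (-(20 * L T.card)) := by
    intro T hT S j
    set F : Matrix (Fin n) (Fin n) ℝ := Matrix.of fun i j => if i ∈ S ∧ j ∈ T then 1 else 0 with hF
    have h := entryInner_similarity_upper hd hp0 hm hi hb hp (F := F)
      (fun i' j => by simp only [hF, Matrix.of_apply]; split_ifs <;> simp) (htilt T hT j)
      (4 ^ g / n * (S.card * T.card) * (Real.exp (tilt n T.card j) - 1) / d ^ 2 + 20 * L T.card)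
    have hblock : ∀ A : Matrix (Fin n) (Fin n) ℝ, entryInner A F = blockSum A S T := fun A => by
      calc _ = ∑ i, if i ∈ S then ∑ j, (if j ∈ T then A i j else 0) else 0 :=
            Finset.sum_congr rfl fun i _ => by
              simp only [hF, Matrix.of_apply]
              split_ifs with h <;> simp [h]
        _ = _ := by simp [blockSum, Finset.sum_ite_mem]
    have hsum : ∑ i, ∑ j, F i j = S.card * T.card := by
      have := hblock (Matrix.of fun _ _ => 1)
      simp only [entryInner, Matrix.of_apply, one_mul, blockSum, Finset.sum_const, nsmul_eq_mul,
        mul_one] at this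
      exact this
    simp only [hblock, hsum] at h
    refine h.trans (Real.exp_le_exp.2 ?_)
    have h0 : 0 ≤ Real.exp (tilt n T.card j) - 1 := by
      linarith [Real.add_one_le_exp (tilt n T.card j), htilt T hT j]
    have h1 : p * (codegree n d * (S.card * T.card)) / (d : ℝ) ^ 2 *
        (Real.exp (tilt n T.card j) - 1) ≤
        4 ^ g / n * (S.card * T.card) * (Real.exp (tilt n T.card j) - 1) / d ^ 2 := by
      rw [div_mul_eq_mul_div, ← mul_assoc p]
      gcongr
    linarith
  have hsub : {ω | ¬ Discrepancy (similarityMatrix fun e => W e ω) (4 ^ g) (20 * (d : ℝ) ^ 2)} ⊆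
      ⋃ T ∈ (Finset.univ : Finset (Fin n)).powerset.erase ∅, {ω | ∃ x ∈ T.powerset ×ˢ
        Finset.range (32 * n), P T x.1 x.2 ω} := by
    intro ω hω
    rw [Set.mem_ofPred_eq, Discrepancy] at hω
    push Not at hω
    obtain ⟨T, hT, S, hS, j, hj, hlt⟩ := hω
    simp only [Set.mem_iUnion]
    refine ⟨T, by simpa using hT.ne_empty, (S, j), by simp [hS, hj], ?_⟩
    simp only [hP]
    refine le_trans (le_of_eq ?_) hlt.le
    simp only [hL]
    field_simp
  have hT : ∀ T ∈ (Finset.univ : Finset (Fin n)).powerset.erase ∅, μ.real {ω | ∃ x ∈ T.powerset ×ˢ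
        Finset.range (32 * n), P T x.1 x.2 ω} ≤
        32 * n * Real.exp (-(19 * L T.card)) := by
    intro T hT
    have hne : T.Nonempty := Finset.nonempty_iff_ne_empty.2 (Finset.mem_erase.1 hT).1
    refine (measureReal_exists_le _ _ fun x _ => hone T hne x.1 x.2).trans ?_
    rw [Finset.card_product, Finset.card_powerset, Finset.card_range]
    push_cast
    have h1 : (2 : ℝ) ^ T.card ≤ Real.exp (L T.card) := by
      have h2 : (2 : ℝ) ≤ Real.exp 1 := by linarith [Real.add_one_le_exp (1 : ℝ)]
      calc (2 : ℝ) ^ T.card ≤ Real.exp 1 ^ T.card := by gcongr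
        _ = Real.exp (T.card * 1) := (Real.exp_nat_mul _ _).symm
        _ ≤ _ := by
          rw [Real.exp_le_exp]
          have h1 : (0 : ℝ) < T.card := by exact_mod_cast hne.card_pos
          have h2 : (T.card : ℝ) ≤ n := by
            exact_mod_cast (Finset.card_le_univ T).trans_eq (Fintype.card_fin n)
          have := Real.log_nonneg ((one_le_div h1).2 h2)
          simp only [hL]
          gcongr
          linarith
    calc (2 : ℝ) ^ T.card * (32 * n) * Real.exp (-(20 * L T.card))
        ≤ Real.exp (L T.card) * (32 * n) * Real.exp (-(20 * L T.card)) := by gcongr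
      _ = 32 * n * (Real.exp (L T.card) * Real.exp (-(20 * L T.card))) := by ring
      _ = _ := by rw [← Real.exp_add]; congr 2; ring
  refine (measureReal_mono hsub (measure_ne_top _ _)).trans ((measureReal_biUnion_finset_le _ _).trans
    ((Finset.sum_le_sum hT).trans ?_))
  have hsplit : ∑ T ∈ (Finset.univ : Finset (Fin n)).powerset.erase ∅,
      32 * n * Real.exp (-(19 * L T.card)) ≤
      ∑ t ∈ Finset.Icc 1 n, (n.choose t : ℝ) * (32 * n * Real.exp (-(19 * L t))) := by
    have hmaps : ∀ T ∈ (Finset.univ : Finset (Fin n)).powerset.erase ∅,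
        T.card ∈ Finset.Icc 1 n := fun T hT => by
      rw [Finset.mem_Icc]
      exact ⟨(Finset.nonempty_iff_ne_empty.2 (Finset.mem_erase.1 hT).1).card_pos,
        (Finset.card_le_univ T).trans_eq (Fintype.card_fin n)⟩
    rw [← Finset.sum_fiberwise_of_maps_to hmaps]
    refine Finset.sum_le_sum fun t _ => ?_
    rw [Finset.sum_congr rfl fun T hT => by rw [(Finset.mem_filter.1 hT).2], Finset.sum_const,
      nsmul_eq_mul]
    gcongr
    calc _ ≤ (Finset.powersetCard t (Finset.univ : Finset (Fin n))).card :=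
          Finset.card_le_card fun T hT => by
            rw [Finset.mem_powersetCard]
            exact ⟨Finset.subset_univ _, (Finset.mem_filter.1 hT).2⟩
      _ = _ := by rw [Finset.card_powersetCard, Finset.card_univ, Fintype.card_fin]
  refine hsplit.trans ((Finset.sum_le_sum (g := fun _ => 32 * n * (1 / (n : ℝ) ^ 18))
    fun t ht => ?_).trans ?_)
  · rw [Finset.mem_Icc] at ht
    calc (n.choose t : ℝ) * (32 * n * Real.exp (-(19 * L t)))
        ≤ Real.exp (L t) * (32 * n * Real.exp (-(19 * L t))) := by
          gcongr
          exact choose_le_exp ht.1 ht.2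
      _ = 32 * n * (Real.exp (L t) * Real.exp (-(19 * L t))) := by ring
      _ = 32 * n * Real.exp (-(18 * L t)) := by rw [← Real.exp_add]; congr 2; ring
      _ ≤ _ := by
          rw [← exp_neg_mul_log (by omega) 18]
          have : Real.log n ≤ L t := log_le_mul_one_add_log ht.1 ht.2
          refine mul_le_mul_of_nonneg_left (Real.exp_le_exp.2 ?_) (by positivity)
          push_cast
          linarith
  · rw [Finset.sum_const, Nat.card_Icc, nsmul_eq_mul, Nat.add_sub_cancel]
    have h32 : (32 : ℝ) ≤ (n : ℝ) ^ 5 := by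
      have : (2 : ℝ) ≤ n := by exact_mod_cast hn
      calc (32 : ℝ) = 2 ^ 5 := by norm_num
        _ ≤ _ := by gcongr
    calc (n : ℝ) * (32 * n * (1 / (n : ℝ) ^ 18)) ≤ n * (n ^ 5 * n * (1 / (n : ℝ) ^ 18)) := by gcongr
      _ = 1 / (n : ℝ) ^ 11 := by field_simp

/-- Truncation at `2 ^ g` is exactly what Bernstein allows with tilt of order `2^(-g)`. Of the
constant 286, 256 pays for the variance `(16 n)²`, 18 for the lattice points, and 12 is left for the
probability. -/
lemma lightPart_tail (hd : 2 ≤ d) (hn : 2 ≤ n) (hp0 : 0 ≤ p)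
    (hm : ∀ e, Measurable (W e)) (hi : iIndepFun W μ)
    (hb : ∀ e, ∀ᵐ ω ∂μ, 0 ≤ W e ω ∧ W e ω ≤ 1) (hp : ∀ e, ∫ ω, W e ω ∂μ ≤ p)
    (hg : n * codegree n d * p ≤ 4 ^ g) :
    μ.real {ω | ∃ z ∈ latticeBall n, 286 * n ≤ ((d : ℝ) ^ 2 * 2 ^ g)⁻¹ *
      |entryInner (deviation μ W ω) (lightPart g z)|} ≤ 1 / (n : ℝ) ^ 11 := by
  have hn0 : (0 : ℝ) < n := by positivity
  have hd0 : (0 : ℝ) < (d : ℝ) ^ 2 := by positivity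
  have hd1 : (1 : ℝ) ≤ (d : ℝ) ^ 2 := by
    have : (1 : ℝ) ≤ d := by exact_mod_cast (by omega : 1 ≤ d)
    exact one_le_pow₀ this
  refine (measureReal_exists_le _ _ (c := 2 * Real.exp (-(30 * n))) fun z hz => ?_).trans ?_
  · have hF1 : ∀ i j, |lightPart g z i j| ≤ 2 ^ g := fun i j => by
      simp only [lightPart, Matrix.of_apply]
      split_ifs with h
      · simp
      · rw [abs_mul, ← Int.cast_abs, ← Int.cast_abs, Int.abs_eq_natAbs, Int.abs_eq_natAbs]
        exact_mod_cast not_lt.1 h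
    have hF2 : ∑ i, ∑ j, lightPart g z i j ^ 2 ≤ (16 * n) ^ 2 := by
      have hz' := mem_latticeBall.1 hz
      calc ∑ i, ∑ j, lightPart g z i j ^ 2 ≤ ∑ i, ∑ j, (z i : ℝ) ^ 2 * (z j : ℝ) ^ 2 := by
            refine Finset.sum_le_sum fun i _ => Finset.sum_le_sum fun j _ => ?_
            simp only [lightPart, Matrix.of_apply]
            split_ifs with h
            · rw [zero_pow two_ne_zero]; positivity
            · rw [mul_pow]
        _ = (∑ i, (z i : ℝ) ^ 2) ^ 2 := by rw [sq (∑ i, _), Finset.sum_mul_sum]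
        _ ≤ _ := pow_le_pow_left₀ (Finset.sum_nonneg fun _ _ => sq_nonneg _) hz' 2
    have h := entryInner_deviation_abs hd hp0 hm hi hb hp (F := lightPart g z)
      (l := ((d : ℝ) ^ 2 * 2 ^ g)⁻¹) (by positivity) (fun i j => by
        calc ((d : ℝ) ^ 2 * 2 ^ g)⁻¹ * d ^ 2 * |lightPart g z i j|
            ≤ ((d : ℝ) ^ 2 * 2 ^ g)⁻¹ * d ^ 2 * 2 ^ g := by gcongr; exact hF1 i j
          _ = 1 := by field_simp) (286 * n)
    refine h.trans (mul_le_mul_of_nonneg_left (Real.exp_le_exp.2 ?_) zero_le_two)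
    have e4 : (4 : ℝ) ^ g = 2 ^ g * 2 ^ g := by rw [← mul_pow]; norm_num
    have h1 : p * ((((d : ℝ) ^ 2 * 2 ^ g)⁻¹) ^ 2 * d ^ 2 *
        (codegree n d * ∑ i, ∑ j, lightPart g z i j ^ 2)) ≤ 256 * n := by
      calc _ ≤ p * ((((d : ℝ) ^ 2 * 2 ^ g)⁻¹) ^ 2 * d ^ 2 * (codegree n d * (16 * n) ^ 2)) := by
            gcongr
        _ = (n * codegree n d * p) / 4 ^ g * (256 * n) / d ^ 2 := by
            rw [e4]; field_simp; ring
        _ ≤ (n * codegree n d * p) / 4 ^ g * (256 * n) := div_le_self (by positivity) hd1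
        _ ≤ 1 * (256 * n) := by
            gcongr
            exact (div_le_one (by positivity)).2 hg
        _ = _ := one_mul _
    linarith
  · have hlog : Real.log n ≤ n := by linarith [Real.log_le_sub_one_of_pos hn0]
    calc ((latticeBall n).card : ℝ) * (2 * Real.exp (-(30 * n)))
        ≤ Real.exp (18 * n) * (2 * Real.exp (-(30 * n))) := by
          gcongr; exact card_latticeBall_le n
      _ = 2 * (Real.exp (18 * n) * Real.exp (-(30 * n))) := by ring
      _ = 2 * Real.exp (-(12 * n)) := by rw [← Real.exp_add]; congr 2; ring
      _ ≤ 2 * (1 / (n : ℝ) ^ 12) := by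
          rw [← exp_neg_mul_log (by omega) 12]
          push_cast
          gcongr
      _ ≤ n * (1 / (n : ℝ) ^ 12) := by
          gcongr
          exact_mod_cast hn
      _ = _ := by field_simp

/-- Spectral bound for the centered similarity matrix of a random weighted hypergraph. -/
theorem spectral_tail (hd : 2 ≤ d) (hn : 2 ≤ n) (hp0 : 0 ≤ p)
    (hm : ∀ e, Measurable (W e)) (hi : iIndepFun W μ)
    (hb : ∀ e, ∀ᵐ ω ∂μ, 0 ≤ W e ω ∧ W e ω ≤ 1) (hp : ∀ e, ∫ ω, W e ω ∂μ ≤ p)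
    (hg : n * codegree n d * p ≤ 4 ^ g) (hlog : Real.log n ≤ 4 ^ g) :
    μ.real {ω | ¬ ∀ x, |quadForm (deviation μ W ω) x| ≤ spectralConst d * 2 ^ g * ∑ i, x i ^ 2} ≤
      3 / (n : ℝ) ^ 11 := by
  have hd0 : (0 : ℝ) < (d : ℝ) ^ 2 := by positivity
  have hm0 : ∀ e, 0 ≤ ∫ ω, W e ω ∂μ := fun e =>
    integral_nonneg_of_ae ((hb e).mono fun ω h => h.1)
  have h1 := rowSum_tail hd hn hp0 hm hi hb hp hg hlog
  have h2 := discrepancy_tail hd hn hp0 hm hi hb hp hg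
  have h3 := lightPart_tail hd hn hp0 hm hi hb hp hg
  have h0 : μ.real {ω | ¬ ∀ e, 0 ≤ W e ω} = 0 := by
    have hae : ∀ᵐ ω ∂μ, ∀ e, 0 ≤ W e ω := Filter.eventually_all.2 fun e => (hb e).mono fun ω h => h.1
    rw [measureReal_def, ae_iff.1 hae, ENNReal.toReal_zero]
  set S1 := {ω | ∃ i ∈ (Finset.univ : Finset (Fin n)),
      14 * (d : ℝ) ^ 2 * 4 ^ g ≤ ∑ j, similarityMatrix (fun e => W e ω) i j}
  set S2 := {ω | ¬ Discrepancy (similarityMatrix fun e => W e ω) (4 ^ g) (20 * (d : ℝ) ^ 2)}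
  set S3 := {ω | ∃ z ∈ latticeBall n, 286 * n ≤ ((d : ℝ) ^ 2 * 2 ^ g)⁻¹ *
      |entryInner (deviation μ W ω) (lightPart g z)|}
  set S0 := {ω | ¬ ∀ e, 0 ≤ W e ω}
  have hsub : {ω | ¬ ∀ x, |quadForm (deviation μ W ω) x| ≤
      spectralConst d * 2 ^ g * ∑ i, x i ^ 2} ⊆ S0 ∪ (S1 ∪ (S2 ∪ S3)) := by
    intro ω hω
    by_contra hcon
    simp only [Set.mem_union, not_or] at hcon
    obtain ⟨c0, c1, c2, c3⟩ := hcon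
    refine hω (quadForm_deviation_le hd hn hm0 hp hg (not_not.1 c0) (fun i => ?_)
      (not_not.1 c2) fun z hz => ?_)
    · by_contra h
      exact c1 ⟨i, Finset.mem_univ i, (not_le.1 h).le⟩
    · by_contra h
      refine c3 ⟨z, hz, ?_⟩
      rw [le_inv_mul_iff₀ (by positivity)]
      linarith
  have hu := (measureReal_mono (μ := μ) hsub).trans (measureReal_union_le _ _)
  have hu1 := measureReal_union_le (μ := μ) S1 (S2 ∪ S3)
  have hu2 := measureReal_union_le (μ := μ) S2 S3
  have e : 3 / (n : ℝ) ^ 11 = 1 / (n : ℝ) ^ 11 + (1 / (n : ℝ) ^ 11 + 1 / (n : ℝ) ^ 11) := by ring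
  linarith

end Events

/-! ### Trace duality and positive semidefinite matrices. -/

section EntryInner

variable {n : ℕ}

lemma entryInner_eq_trace (A B : Matrix (Fin n) (Fin n) ℝ) :
    entryInner A B = (A * B.transpose).trace := by
  simp [entryInner, Matrix.trace, Matrix.mul_apply]

lemma entryInner_add_right (A B C : Matrix (Fin n) (Fin n) ℝ) :
    entryInner A (B + C) = entryInner A B + entryInner A C := by
  simp only [entryInner_eq_trace, Matrix.transpose_add, mul_add, Matrix.trace_add]

lemma entryInner_sub_right (A B C : Matrix (Fin n) (Fin n) ℝ) :
    entryInner A (B - C) = entryInner A B - entryInner A C := by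
  simp only [entryInner_eq_trace, Matrix.transpose_sub, mul_sub, Matrix.trace_sub]

lemma entryInner_mul_right (A P B : Matrix (Fin n) (Fin n) ℝ) :
    entryInner A (P * B) = entryInner (P.transpose * A) B := by
  rw [entryInner_eq_trace, entryInner_eq_trace, Matrix.transpose_mul, ← mul_assoc,
    Matrix.trace_mul_comm, mul_assoc]

lemma entryInner_mul_left (A P B : Matrix (Fin n) (Fin n) ℝ) :
    entryInner A (B * P) = entryInner (A * P.transpose) B := by
  rw [entryInner_eq_trace, entryInner_eq_trace, Matrix.transpose_mul, mul_assoc]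

lemma entryInner_one (A : Matrix (Fin n) (Fin n) ℝ) : entryInner 1 A = ∑ i, A i i := by
  rw [entryInner_eq_trace, one_mul, Matrix.trace_transpose]; rfl

lemma abs_entryInner_le {A B : Matrix (Fin n) (Fin n) ℝ} {c : ℝ} (h : ∀ i j, |A i j| ≤ c) :
    |entryInner A B| ≤ c * ∑ i, ∑ j, |B i j| := by
  simp only [entryInner, Finset.mul_sum]
  refine (Finset.abs_sum_le_sum_abs _ _).trans (Finset.sum_le_sum fun i _ => ?_)
  refine (Finset.abs_sum_le_sum_abs _ _).trans (Finset.sum_le_sum fun j _ => ?_)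
  rw [abs_mul]
  exact mul_le_mul_of_nonneg_right (h i j) (abs_nonneg _)

open scoped MatrixOrder in
lemma exists_gram {Y : Matrix (Fin n) (Fin n) ℝ} (hY : Y.PosSemidef) :
    ∃ B : Matrix (Fin n) (Fin n) ℝ, Y = B.transpose * B := by
  obtain ⟨B, hB⟩ := CStarAlgebra.nonneg_iff_eq_star_mul_self.mp hY.nonneg
  refine ⟨B, hB.trans ?_⟩
  rw [Matrix.star_eq_conjTranspose, Matrix.conjTranspose_eq_transpose_of_trivial]

/-- In Gram form this is `‖B_i - B_j‖² ≥ 0` for the columns of `B`. -/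
lemma two_mul_entry_le {Y : Matrix (Fin n) (Fin n) ℝ} (hY : Y.PosSemidef) (i j : Fin n) :
    2 * Y i j ≤ Y i i + Y j j := by
  obtain ⟨B, rfl⟩ := exists_gram hY
  simp only [Matrix.mul_apply, Matrix.transpose_apply, Finset.mul_sum, ← Finset.sum_add_distrib]
  refine Finset.sum_le_sum fun l _ => ?_
  nlinarith [sq_nonneg (B l i - B l j)]

/-- Pairing with a positive semidefinite matrix is controlled by the quadratic form. -/
lemma abs_entryInner_le_trace {D Y : Matrix (Fin n) (Fin n) ℝ} {M : ℝ} (hY : Y.PosSemidef)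
    (hD : ∀ x, |quadForm D x| ≤ M * ∑ i, x i ^ 2) :
    |entryInner D Y| ≤ M * entryInner 1 Y := by
  obtain ⟨B, rfl⟩ := exists_gram hY
  have h1 : entryInner D (B.transpose * B) = ∑ l, quadForm D (B l) := by
    simp only [entryInner, quadForm, Matrix.mul_apply, Matrix.transpose_apply, Finset.mul_sum]
    rw [Finset.sum_congr rfl fun i _ => Finset.sum_comm, Finset.sum_comm]
  have h2 : entryInner 1 (B.transpose * B) = ∑ l, ∑ i, B l i ^ 2 := by
    simp only [entryInner_one, Matrix.mul_apply, Matrix.transpose_apply, sq]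
    exact Finset.sum_comm
  rw [h1, h2, Finset.mul_sum]
  exact (Finset.abs_sum_le_sum_abs _ _).trans (Finset.sum_le_sum fun l _ => hD _)

end EntryInner

/-! ### Cluster matrices and the deterministic optimality criterion. -/

section ClusterMatrix

variable {n k s : ℕ} {Φ : Fin n → Option (Fin k)}

lemma clusterMatrix_apply (i j : Fin n) :
    clusterMatrix Φ i j = if Φ i ≠ none ∧ Φ i = Φ j then 1 else 0 := by
  simp only [clusterMatrix, membershipMatrix, Matrix.mul_apply, Matrix.of_apply,
    Matrix.transpose_apply]
  cases h : Φ i with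
  | none => simp
  | some a =>
    rw [Finset.sum_eq_single a]
    · simp [eq_comm]
    · intro b _ hb; simp [hb.symm]
    · simp

lemma clusterMatrix_symm (i j : Fin n) : clusterMatrix Φ i j = clusterMatrix Φ j i := by
  simp only [clusterMatrix_apply]
  refine if_congr ⟨?_, ?_⟩ rfl rfl <;> rintro ⟨h, h'⟩ <;> exact ⟨h' ▸ h, h'.symm⟩

lemma clusterMatrix_transpose : (clusterMatrix Φ).transpose = clusterMatrix Φ := by
  ext i j; exact clusterMatrix_symm j i

lemma clusterMatrix_mul_of_some {i : Fin n} {a : Fin k} (h : Φ i = some a) (f : Fin n → ℝ) :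
    ∑ j, clusterMatrix Φ i j * f j = ∑ j ∈ cluster Φ a, f j := by
  simp [clusterMatrix_apply, h, cluster, Finset.sum_filter, eq_comm]

lemma clusterMatrix_of_none {i : Fin n} (h : Φ i = none) (j : Fin n) : clusterMatrix Φ i j = 0 := by
  simp [clusterMatrix_apply, h]

lemma clusterMatrix_row_sum (hs : ∀ a, (cluster Φ a).card = s) (i : Fin n) :
    ∑ j, clusterMatrix Φ i j = s * clusterMatrix Φ i i := by
  cases h : Φ i with
  | none => simp [clusterMatrix_of_none h]
  | some a =>
    have := clusterMatrix_mul_of_some h fun _ => 1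
    simp only [mul_one, Finset.sum_const, hs, nsmul_eq_mul] at this
    rw [this]
    simp [clusterMatrix_apply, h]

lemma clusterMatrix_trace (hs : ∀ a, (cluster Φ a).card = s) :
    ∑ i, clusterMatrix Φ i i = k * s := by
  simp only [clusterMatrix, membershipMatrix, Matrix.mul_apply, Matrix.of_apply,
    Matrix.transpose_apply]
  rw [Finset.sum_comm]
  have : ∀ a, ∑ i, (if Φ i = some a then (1 : ℝ) else 0) * (if Φ i = some a then 1 else 0) = s :=
    fun a => by
      simp only [mul_ite, mul_one, mul_zero, ← ite_and, and_self]
      rw [Finset.sum_boole, ← hs a, cluster]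
  rw [Finset.sum_congr rfl fun a _ => this a]
  simp

lemma clusterMatrix_sum (hs : ∀ a, (cluster Φ a).card = s) :
    ∑ i, ∑ j, clusterMatrix Φ i j = k * s ^ 2 := by
  simp only [clusterMatrix_row_sum hs, ← Finset.mul_sum, clusterMatrix_trace hs]
  ring

lemma clusterMatrix_sq (hs : ∀ a, (cluster Φ a).card = s) :
    clusterMatrix Φ * clusterMatrix Φ = (s : ℝ) • clusterMatrix Φ := by
  ext i j
  rw [Matrix.mul_apply, Matrix.smul_apply, smul_eq_mul]
  cases h : Φ i with
  | none => simp [clusterMatrix_of_none h]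
  | some a =>
    rw [clusterMatrix_mul_of_some h, ← hs a, ← nsmul_eq_mul, ← Finset.sum_const]
    refine Finset.sum_congr rfl fun l hl => ?_
    have : Φ l = some a := by simpa [cluster] using hl
    simp [clusterMatrix_apply, h, this]

lemma clusterMatrix_mem (i j : Fin n) : clusterMatrix Φ i j = 0 ∨ clusterMatrix Φ i j = 1 := by
  rw [clusterMatrix_apply]; split_ifs <;> simp

lemma clusterMatrix_feasible (hs : ∀ a, (cluster Φ a).card = s) :
    clusterMatrix Φ ∈ sdpFeasible n (k * s) (k * s ^ 2) := by
  refine ⟨?_, fun i j => ?_, ?_, ?_⟩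
  · have := Matrix.posSemidef_self_mul_conjTranspose (membershipMatrix Φ)
    rwa [Matrix.conjTranspose_eq_transpose_of_trivial] at this
  · rcases clusterMatrix_mem (Φ := Φ) i j with h | h <;> simp [h]
  · rw [entryInner_one, clusterMatrix_trace hs]
  · simpa [entryInner] using clusterMatrix_sum hs

/-- A deterministic condition for a perturbed block matrix to have the cluster matrix as the unique
solution of the semidefinite program. -/
theorem isUniqueSDPOptimal_of_perturbation (hs2 : 2 ≤ s) (hs : ∀ a, (cluster Φ a).card = s)
    {A D : Matrix (Fin n) (Fin n) ℝ} {b c : ℝ} (hc : 0 < c)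
    (hA : ∀ i j, A i j = (if i = j then 0 else b + c * clusterMatrix Φ i j) + D i j)
    (hDs : ∀ i j, D i j = D j i)
    (hrow : ∀ i a, |∑ j ∈ cluster Φ a, D i j| ≤ s * c / 24)
    (hquad : ∀ x, |quadForm D x| ≤ s * c / 8 * ∑ i, x i ^ 2) :
    IsUniqueSDPOptimal A (k * s) (k * s ^ 2) (clusterMatrix Φ) := by
  have hs2' : (2 : ℝ) ≤ s := by exact_mod_cast hs2
  have hs0 : (0 : ℝ) < s := by linarith
  have hXf := clusterMatrix_feasible hs
  set X := clusterMatrix Φ with hX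
  suffices key : ∀ Y ∈ sdpFeasible n (k * s) (k * s ^ 2),
      (∀ i j, 0 ≤ X i j * (X - Y) i j) ∧
      (∑ i, ∑ j, |(X - Y) i j| = 2 * entryInner X (X - Y)) ∧
      c / 8 * entryInner X (X - Y) ≤ entryInner A (X - Y) by
    have hge : ∀ Y ∈ sdpFeasible n (k * s) (k * s ^ 2), 0 ≤ entryInner X (X - Y) := fun Y hY =>
      Finset.sum_nonneg fun i _ => Finset.sum_nonneg fun j _ => (key Y hY).1 i j
    refine ⟨⟨hXf, fun Y hY => ?_⟩, fun Y hY => ?_⟩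
    · have h1 := (key Y hY).2.2
      rw [entryInner_sub_right A] at h1
      have := mul_nonneg (by positivity : 0 ≤ c / 8) (hge Y hY)
      linarith
    · have h1 := (key Y hY.1).2.2
      rw [entryInner_sub_right A] at h1
      have h2 := hY.2 X hXf
      have h3 : entryInner X (X - Y) ≤ 0 := by
        by_contra hcon
        have := mul_pos (by positivity : 0 < c / 8) (not_le.1 hcon)
        linarith
      have h4 : ∑ i, ∑ j, |(X - Y) i j| ≤ 0 := by linarith [(key Y hY.1).2.1]
      ext i j
      have h5 : |(X - Y) i j| ≤ ∑ i, ∑ j, |(X - Y) i j| :=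
        (Finset.single_le_sum (f := fun j => |(X - Y) i j|) (fun _ _ => abs_nonneg _)
          (Finset.mem_univ j)).trans (Finset.single_le_sum (f := fun i => ∑ j, |(X - Y) i j|)
          (fun _ _ => Finset.sum_nonneg fun _ _ => abs_nonneg _) (Finset.mem_univ i))
      have h6 := abs_nonpos_iff.1 (h5.trans h4)
      rw [Matrix.sub_apply] at h6
      linarith
  intro Y hY
  set H := X - Y with hH
  set δ := entryInner X H with hδ
  have hHapp : ∀ i j, H i j = X i j - Y i j := fun i j => rfl
  have hone_app : ∀ Z : Matrix (Fin n) (Fin n) ℝ,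
      entryInner (Matrix.of fun _ _ => 1) Z = ∑ i, ∑ j, Z i j := fun Z => by simp [entryInner]
  have hHsum : ∑ i, ∑ j, H i j = 0 := by
    rw [← hone_app, hH, entryInner_sub_right, hXf.2.2.2, hY.2.2.2, sub_self]
  have hHtr : ∑ i, H i i = 0 := by
    rw [← entryInner_one, hH, entryInner_sub_right, hXf.2.2.1, hY.2.2.1, sub_self]
  have hpos : ∀ i j, 0 ≤ X i j * H i j := fun i j => by
    have := (hY.2.1 i j).2
    rcases clusterMatrix_mem (Φ := Φ) i j with h | h <;> rw [← hX] at h <;> simp [hHapp, h, this]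
  -- `H` is nonnegative where `X = 1` and nonpositive where `X = 0`.
  have habs : ∀ i j, |H i j| = 2 * (X i j * H i j) - H i j := fun i j => by
    obtain ⟨h0, h1⟩ := hY.2.1 i j
    rcases clusterMatrix_mem (Φ := Φ) i j with h | h <;> rw [← hX] at h
    · simp [hHapp, h, abs_of_nonneg h0]
    · rw [hHapp, h, abs_of_nonneg (by linarith)]; ring
  have hl1 : ∑ i, ∑ j, |H i j| = 2 * δ := by
    simp only [habs, Finset.sum_sub_distrib, hHsum, sub_zero, ← Finset.mul_sum]
    rfl
  refine ⟨hpos, hl1, ?_⟩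
  have hδ0 : 0 ≤ δ := Finset.sum_nonneg fun i _ => Finset.sum_nonneg fun j _ => hpos i j
  -- the diagonal
  have hdiag : s * ∑ i, X i i * H i i ≤ δ := by
    -- Inside a block, `2 Y i j ≤ Y i i + Y j j` becomes `H i i + H j j ≤ 2 H i j`; summing produces
    -- the factor `s`.
    have h1 : ∀ i j, X i j * H i i + X i j * H j j ≤ 2 * (X i j * H i j) := fun i j => by
      have h2 := two_mul_entry_le hY.1 i j
      rcases clusterMatrix_mem (Φ := Φ) i j with h | h
      · rw [← hX] at h; simp [h]
      · have hcond : Φ i ≠ none ∧ Φ i = Φ j := by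
          by_contra hcon; rw [clusterMatrix_apply, if_neg hcon] at h; norm_num at h
        have hi : X i i = 1 := by rw [hX, clusterMatrix_apply, if_pos ⟨hcond.1, rfl⟩]
        have hj : X j j = 1 := by
          rw [hX, clusterMatrix_apply, if_pos ⟨hcond.2 ▸ hcond.1, rfl⟩]
        rw [← hX] at h
        rw [hHapp, hHapp, hHapp, h, hi, hj]
        linarith
    have h2 : ∑ i, ∑ j, X i j * H i i = s * ∑ i, X i i * H i i := by
      simp only [← Finset.sum_mul, Finset.mul_sum]
      refine Finset.sum_congr rfl fun i _ => ?_
      rw [hX, clusterMatrix_row_sum hs]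
      ring
    have h3 : ∑ i, ∑ j, X i j * H j j = s * ∑ i, X i i * H i i := by
      rw [← h2, Finset.sum_comm]
      refine Finset.sum_congr rfl fun i _ => Finset.sum_congr rfl fun j _ => ?_
      rw [hX, clusterMatrix_symm]
    have h4 : ∑ i, ∑ j, (X i j * H i i + X i j * H j j) ≤ ∑ i, ∑ j, 2 * (X i j * H i j) :=
      Finset.sum_le_sum fun i _ => Finset.sum_le_sum fun j _ => h1 i j
    simp only [Finset.sum_add_distrib, ← Finset.mul_sum] at h4
    rw [h2, h3] at h4
    have h5 : δ = ∑ i, ∑ j, X i j * H i j := rfl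
    linarith
  -- Here `2 ≤ s` enters: the zero diagonal of the mean costs at most half of the gain.
  have hdiag' : ∑ i, X i i * H i i ≤ δ / 2 := by
    have h0 : 0 ≤ ∑ i, X i i * H i i := Finset.sum_nonneg fun i _ => hpos i i
    nlinarith
  -- the expected part
  have hmean : c * (δ / 2) ≤ entryInner A H - entryInner D H := by
    have h1 : entryInner A H - entryInner D H = ∑ i, ∑ j, ((b * H i j + c * (X i j * H i j)) -
        if i = j then b * H i j + c * (X i j * H i j) else 0) := by
      simp only [entryInner, ← Finset.sum_sub_distrib]
      refine Finset.sum_congr rfl fun i _ => Finset.sum_congr rfl fun j _ => ?_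
      rw [hA]
      split_ifs <;> ring
    rw [h1]
    simp only [Finset.sum_sub_distrib, Finset.sum_add_distrib, ← Finset.mul_sum, hHsum,
      Finset.sum_ite_eq, Finset.mem_univ, if_true, hHtr]
    have h5 : δ = ∑ i, ∑ j, X i j * H i j := rfl
    rw [← h5]
    nlinarith
  -- the noise
  set P := (s : ℝ)⁻¹ • X with hP
  have hXX : X * X = (s : ℝ) • X := clusterMatrix_sq hs
  have hPt : P.transpose = P := by
    rw [hP, Matrix.transpose_smul, hX, clusterMatrix_transpose]
  have hXP : X * P = X := by
    rw [hP, Matrix.mul_smul, hXX, smul_smul, inv_mul_cancel₀ hs0.ne', one_smul]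
  have hPP : P * P = P := by
    nth_rw 1 [hP]
    rw [Matrix.smul_mul, hXP]
  have hPapp : ∀ i j, P i j = (s : ℝ)⁻¹ * X i j := fun i j => rfl
  have hPD : ∀ i j, |(P * D) i j| ≤ c / 24 := fun i j => by
    have e : (P * D) i j = (s : ℝ)⁻¹ * ∑ l, X i l * D j l := by
      rw [Matrix.mul_apply, Finset.mul_sum]
      refine Finset.sum_congr rfl fun l _ => ?_
      rw [hPapp, hDs l j, mul_assoc]
    rw [e]
    cases h : Φ i with
    | none =>
      simp only [hX, clusterMatrix_of_none h, zero_mul, Finset.sum_const_zero, mul_zero, abs_zero]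
      positivity
    | some a =>
      rw [hX, clusterMatrix_mul_of_some h, abs_mul, abs_of_pos (by positivity),
        inv_mul_le_iff₀ hs0]
      exact (hrow j a).trans_eq (by ring)
  have hDP : ∀ i j, |(D * P) i j| ≤ c / 24 := fun i j => by
    have hDt : D.transpose = D := by ext i j; exact hDs j i
    have : (D * P) i j = (P * D) j i := by
      rw [← Matrix.transpose_apply (P * D), Matrix.transpose_mul, hDt, hPt]
    rw [this]; exact hPD j i
  have hPDP : ∀ i j, |(P * D * P) i j| ≤ c / 24 := fun i j => by
    have hP0 : ∀ l, 0 ≤ P l j := fun l => by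
      rw [hPapp]
      rcases clusterMatrix_mem (Φ := Φ) l j with h | h <;> rw [← hX] at h <;> rw [h]
      exacts [by positivity, by positivity]
    have hcol : ∑ l, P l j ≤ 1 := by
      have e : ∑ l, P l j = (s : ℝ)⁻¹ * ∑ l, X j l := by
        rw [Finset.mul_sum]
        exact Finset.sum_congr rfl fun l _ => by rw [hPapp, hX, clusterMatrix_symm]
      rw [e, hX, clusterMatrix_row_sum hs, inv_mul_cancel_left₀ hs0.ne']
      rcases clusterMatrix_mem (Φ := Φ) j j with h | h <;> simp [h]
    calc |(P * D * P) i j| ≤ ∑ l, |(P * D) i l| * P l j := by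
          rw [Matrix.mul_apply]
          refine (Finset.abs_sum_le_sum_abs _ _).trans_eq (Finset.sum_congr rfl fun l _ => ?_)
          rw [abs_mul, abs_of_nonneg (hP0 l)]
      _ ≤ ∑ l, c / 24 * P l j := Finset.sum_le_sum fun l _ =>
          mul_le_mul_of_nonneg_right (hPD i l) (hP0 l)
      _ = c / 24 * ∑ l, P l j := by rw [Finset.mul_sum]
      _ ≤ c / 24 * 1 := by gcongr
      _ = c / 24 := mul_one _
  set R := 1 - P with hR
  have hRt : R.transpose = R := by
    rw [hR, Matrix.transpose_sub, Matrix.transpose_one, hPt]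
  have hRR : R * R = R := by
    rw [hR, sub_mul, mul_sub, mul_sub, one_mul, mul_one, one_mul, hPP, sub_self, sub_zero]
  have hXR : X * R = 0 := by rw [hR, mul_sub, mul_one, hXP, sub_self]
  -- Compressing by `R` kills `X`, so `R H R = -R Y R`, which has a sign.
  have hdecomp : H = P * H + H * P - P * H * P - R * Y * R := by
    have h1 : R * H * R = - (R * Y * R) := by
      rw [hH, mul_sub R X Y, sub_mul (R * X) (R * Y) R, mul_assoc R X R, hXR, mul_zero, zero_sub]
    have h2 : ∀ H P : Matrix (Fin n) (Fin n) ℝ,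
        H = P * H + H * P - P * H * P + (1 - P) * H * (1 - P) := fun H P => by noncomm_ring
    calc H = P * H + H * P - P * H * P + R * H * R := h2 H P
      _ = _ := by rw [h1, ← sub_eq_add_neg]
  have hZ : (R * Y * R).PosSemidef := by
    have := hY.1.mul_mul_conjTranspose_same R
    rwa [Matrix.conjTranspose_eq_transpose_of_trivial, hRt] at this
  -- The trace is `tr Y - ⟨X, Y⟩ / s = k s - (k s² - δ)/s`.
  have htrZ : entryInner 1 (R * Y * R) = δ / s := by
    have h1 : entryInner 1 (R * Y * R) = entryInner R Y := by
      rw [entryInner_mul_left, entryInner_mul_right, hRt, one_mul, hRR]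
    have h2 : entryInner R Y = entryInner 1 Y - (s : ℝ)⁻¹ * entryInner X Y := by
      simp only [entryInner, hR, hPapp, Matrix.sub_apply, Finset.mul_sum, ← Finset.sum_sub_distrib]
      exact Finset.sum_congr rfl fun i _ => Finset.sum_congr rfl fun j _ => by ring
    have h3 : entryInner X X = k * s ^ 2 := by
      rw [← clusterMatrix_sum hs, ← hX]
      refine Finset.sum_congr rfl fun i _ => Finset.sum_congr rfl fun j _ => ?_
      rcases clusterMatrix_mem (Φ := Φ) i j with h | h <;> rw [← hX] at h <;> rw [h] <;> norm_num
    rw [h1, h2, hY.2.2.1, hδ, hH, entryInner_sub_right, h3]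
    field_simp
  -- The noise totals `cδ/4 + cδ/8`; against the gain `cδ/2` this leaves `cδ/8`.
  have hnoise : |entryInner D H| ≤ 3 * (c / 24 * (2 * δ)) + s * c / 8 * (δ / s) := by
    have e : entryInner D H = entryInner (P * D) H + entryInner (D * P) H
        - entryInner (P * D * P) H - entryInner D (R * Y * R) := by
      nth_rw 1 [hdecomp]
      rw [entryInner_sub_right, entryInner_sub_right, entryInner_add_right, entryInner_mul_right,
        entryInner_mul_left, mul_assoc P H P, entryInner_mul_right D P (H * P),
        entryInner_mul_left (P.transpose * D), hPt]
    have h1 := abs_entryInner_le (B := H) hPD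
    have h2 := abs_entryInner_le (B := H) hDP
    have h3 := abs_entryInner_le (B := H) hPDP
    have h4 := abs_entryInner_le_trace hZ hquad
    rw [htrZ] at h4
    rw [hl1] at h1 h2 h3
    rw [e]
    rw [abs_le] at *
    constructor <;> linarith [h1.1, h1.2, h2.1, h2.2, h3.1, h3.2, h4.1, h4.2]
  have e : s * c / 8 * (δ / s) = c / 8 * δ := by field_simp
  rw [e] at hnoise
  have := (abs_le.1 hnoise).1
  linarith

end ClusterMatrix

/-! ### Exact recovery under the signal-to-noise condition. -/

section Recovery

variable {n k s d : ℕ} {Φ : Fin n → Option (Fin k)}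

lemma one_le_spectralConst (d : ℕ) : 1 ≤ spectralConst d := by
  unfold spectralConst
  have : (0 : ℝ) ≤ (d : ℝ) ^ 2 := by positivity
  linarith

/-- The signal-to-noise constant for exact recovery. -/
def recoveryConst (d : ℕ) : ℝ := 2 + 256 * spectralConst d ^ 2 + 32256 * (d : ℝ) ^ 2

lemma recoveryConst_bounds (d : ℕ) : 2 ≤ recoveryConst d ∧
    256 * spectralConst d ^ 2 ≤ recoveryConst d ∧ 32256 * (d : ℝ) ^ 2 ≤ recoveryConst d := by
  have h1 : 0 ≤ spectralConst d ^ 2 := sq_nonneg _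
  have h2 : (0 : ℝ) ≤ (d : ℝ) ^ 2 := sq_nonneg _
  unfold recoveryConst
  refine ⟨?_, ?_, ?_⟩ <;> linarith

/-- Without clusters, the semidefinite program has only the zero solution. -/
lemma isUniqueSDPOptimal_of_no_cluster (A : Matrix (Fin n) (Fin n) ℝ) (s : ℕ)
    (Φ : Fin n → Option (Fin 0)) :
    IsUniqueSDPOptimal A (((0 : ℕ) : ℝ) * s) (((0 : ℕ) : ℝ) * s ^ 2) (clusterMatrix Φ) := by
  have hX : clusterMatrix Φ ∈ sdpFeasible n (((0 : ℕ) : ℝ) * s) (((0 : ℕ) : ℝ) * s ^ 2) :=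
    clusterMatrix_feasible fun a => a.elim0
  have hzero : ∀ Y ∈ sdpFeasible n (((0 : ℕ) : ℝ) * s) (((0 : ℕ) : ℝ) * s ^ 2), Y = 0 := by
    intro Y hY
    have h1 := hY.2.2.2
    simp only [entryInner, Matrix.of_apply, one_mul, Nat.cast_zero, zero_mul] at h1
    ext i j
    have h2 := (Finset.sum_eq_zero_iff_of_nonneg fun i _ =>
      Finset.sum_nonneg fun j _ => (hY.2.1 i j).1).1 h1 i (Finset.mem_univ i)
    exact (Finset.sum_eq_zero_iff_of_nonneg fun j _ => (hY.2.1 i j).1).1 h2 j (Finset.mem_univ j)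
  refine ⟨⟨hX, fun Y hY => ?_⟩, fun Y hY => ?_⟩
  · rw [hzero _ hX, hzero _ hY]
  · rw [hzero _ hX, hzero _ hY.1]

/-- The expected similarity matrix is a block matrix. -/
lemma mean_similarity_eq (hd : 2 ≤ d) (hs : ∀ a, (cluster Φ a).card = s) {m : Edge n d → ℝ}
    {p q : ℝ} (hp : ∀ e, Homogeneous Φ e → m e = p) (hq : ∀ e, ¬ Homogeneous Φ e → m e = q)
    (i j : Fin n) :
    similarityMatrix m i j = if i = j then 0 else
      codegree n d * q + ((s - 2).choose (d - 2) : ℝ) * (p - q) * clusterMatrix Φ i j := by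
  rw [similarityMatrix, Matrix.of_apply]
  split_ifs with hij
  · rfl
  rw [clusterMatrix_apply]
  split_ifs with h
  · obtain ⟨a, ha⟩ := Option.ne_none_iff_exists'.1 h.1
    have hia : i ∈ cluster Φ a := by simp [cluster, ha]
    have hja : j ∈ cluster Φ a := by simp [cluster, ← h.2, ha]
    have hm : ∀ e ∈ Finset.univ.filter (fun e : Edge n d => i ∈ e.1 ∧ j ∈ e.1),
        m e = q + if e.1 ⊆ cluster Φ a then p - q else 0 := fun e he => by
      split_ifs with hsub
      · rw [hp e ⟨a, hsub⟩]; ring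
      · rw [hq e, add_zero]
        rintro ⟨b, hb⟩
        have : Φ i = some b := by
          simpa [cluster] using hb (Finset.mem_filter.1 he).2.1
        rw [ha] at this
        exact hsub (Option.some.inj this ▸ hb)
    rw [Finset.sum_congr rfl hm, Finset.sum_add_distrib, Finset.sum_const,
      card_edges_containing hd hij, ← Finset.sum_filter, Finset.filter_filter, Finset.sum_const,
      card_edges_containing_pair hd hij _ hia hja, hs, nsmul_eq_mul, nsmul_eq_mul, mul_one]
  · have hm : ∀ e ∈ Finset.univ.filter (fun e : Edge n d => i ∈ e.1 ∧ j ∈ e.1), m e = q :=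
      fun e he => hq e fun ⟨b, hb⟩ => h (by
        have h1 : Φ i = some b := by simpa [cluster] using hb (Finset.mem_filter.1 he).2.1
        have h2 : Φ j = some b := by simpa [cluster] using hb (Finset.mem_filter.1 he).2.2
        simp [h1, h2])
    rw [Finset.sum_congr rfl hm, Finset.sum_const, card_edges_containing hd hij, nsmul_eq_mul,
      mul_zero, add_zero]

/-- The consequences of the signal-to-noise condition used in the recovery theorem. -/
lemma snr_consequences {n s d : ℕ} {p q : ℝ} (hd : 2 ≤ d) (hdn : d ≤ n) (hsn : s ≤ n)
    (hq0 : 0 ≤ q) (hqp : q < p) (hp1 : p ≤ 1)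
    (hsnr : recoveryConst d * codegree n d * p * (s * Real.log n + n) ≤
      (s : ℝ) ^ 2 * ((s - 2).choose (d - 2) : ℝ) ^ 2 * (p - q) ^ 2) :
    2 ≤ s ∧ 0 < ((s - 2).choose (d - 2) : ℝ) * (p - q) ∧
    ((s - 2).choose (d - 2) : ℝ) * (p - q) ≤ codegree n d * p ∧
    32256 * (d : ℝ) ^ 2 * (codegree n d * p * Real.log n) ≤
      s * (((s - 2).choose (d - 2) : ℝ) * (p - q)) ^ 2 ∧
    ∃ g : ℕ, n * codegree n d * p ≤ 4 ^ g ∧ Real.log n ≤ 4 ^ g ∧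
      spectralConst d * 2 ^ g ≤ s * (((s - 2).choose (d - 2) : ℝ) * (p - q)) / 8 := by
  have hn : 2 ≤ n := hd.trans hdn
  have hn2 : (2 : ℝ) ≤ n := by exact_mod_cast hn
  have hn0 : (0 : ℝ) < n := by linarith
  have hp0 : 0 < p := hq0.trans_lt hqp
  obtain ⟨hC2, hCs, hCd⟩ := recoveryConst_bounds d
  set C := recoveryConst d with hC
  set N := codegree n d with hNdef
  set G : ℝ := ((s - 2).choose (d - 2) : ℝ) with hG
  set c := G * (p - q) with hc
  have hN1 : 1 ≤ N := by
    rw [hNdef]; exact_mod_cast Nat.choose_pos (by omega)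
  have hN0 : 0 < N := by linarith
  have hGN : G ≤ N := by
    rw [hG, hNdef]; exact_mod_cast Nat.choose_le_choose _ (by omega)
  have hG0 : 0 ≤ G := Nat.cast_nonneg _
  have hsnr' : C * N * p * (s * Real.log n + n) ≤ (s : ℝ) ^ 2 * c ^ 2 := by
    rw [hc, mul_pow, ← mul_assoc]; exact hsnr
  have hlog0 : 0 ≤ Real.log n := Real.log_nonneg (by linarith)
  have hs0' : (0 : ℝ) ≤ s := Nat.cast_nonneg _
  have hslog : 0 ≤ (s : ℝ) * Real.log n := mul_nonneg hs0' hlog0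
  have hCNp : 0 < C * N * p := by positivity
  -- For `s ≤ 1` truncated subtraction leaves `choose 0 (d - 2) ≤ 1`, so the signal is at most `p² ≤
  -- p`, whereas the noise side is at least `4 p`.
  have hs2 : 2 ≤ s := by
    by_contra hcon
    have hs1 : (s : ℝ) ≤ 1 := by exact_mod_cast (by omega : s ≤ 1)
    have hG1 : G ≤ 1 := by
      have h0 : s - 2 = 0 := by omega
      rw [hG, h0]
      cases d - 2 <;> simp
    have h1 : c ≤ p := by rw [hc]; nlinarith
    have hc0 : 0 ≤ c := mul_nonneg hG0 (by linarith)
    have h2 : (s : ℝ) ^ 2 * c ^ 2 ≤ 1 * p ^ 2 := by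
      gcongr
      exact pow_le_one₀ hs0' hs1
    have h3 : p ^ 2 ≤ p := by nlinarith [hp1]
    have h4 : 2 * 1 * p * 2 ≤ C * N * p * (s * Real.log n + n) := by
      gcongr
      linarith
    linarith
  have hs0 : (0 : ℝ) < s := by exact_mod_cast (by omega : 0 < s)
  have hc0 : 0 < c := by
    have h1 : 0 < (s : ℝ) ^ 2 * c ^ 2 := (mul_pos hCNp (by linarith)).trans_le hsnr'
    have h2 : c ≠ 0 := by rintro h; rw [h] at h1; simp at h1
    exact lt_of_le_of_ne (mul_nonneg hG0 (by linarith)) h2.symm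
  have hcN : c ≤ N * p := by
    rw [hc]
    exact mul_le_mul hGN (by linarith) (by linarith) hN0.le
  have hsnr1 : C * N * p * n ≤ (s * c) ^ 2 := by
    rw [mul_pow]; nlinarith
  have hsnr2 : C * (N * p * Real.log n) ≤ s * c ^ 2 := by
    have h1 : s * (C * (N * p * Real.log n)) ≤ s * (s * c ^ 2) := by
      have := mul_pos hCNp hn0
      nlinarith
    exact le_of_mul_le_mul_left h1 hs0
  -- With `c ≤ N p` and `s ≤ n`, the signal condition itself yields the density `n N p ≥ log n`
  -- needed for the spectral bound.
  have hsnr3 : C * Real.log n ≤ n * N * p := by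
    have h1 : (N * p) * (C * Real.log n) ≤ (N * p) * (s * (N * p)) := by
      calc (N * p) * (C * Real.log n) = C * (N * p * Real.log n) := by ring
        _ ≤ s * c ^ 2 := hsnr2
        _ ≤ s * (N * p) ^ 2 := by gcongr
        _ = _ := by ring
    have h2 := le_of_mul_le_mul_left h1 (by positivity)
    have h3 : (s : ℝ) ≤ n := by exact_mod_cast hsn
    calc _ ≤ _ := h2
      _ ≤ n * (N * p) := by gcongr
      _ = _ := by ring
  have hlog2 : 1 / 2 ≤ Real.log n :=
    (by linarith [Real.log_two_gt_d9] : 1 / 2 ≤ Real.log 2).trans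
      (Real.log_le_log (by norm_num) hn2)
  have hone : 1 ≤ n * N * p := by nlinarith
  have hlogle : Real.log n ≤ n * N * p := by nlinarith
  -- Bracketing by powers of 4 gives `n N p < 4 ^ g ≤ 4 n N p`. The constant 256 is this 4 times
  -- `8²`.
  obtain ⟨g', hg1, hg2⟩ := exists_nat_pow_near hone (by norm_num : (1 : ℝ) < 4)
  have hgle : (4 : ℝ) ^ (g' + 1) ≤ 4 * (n * N * p) := by rw [pow_succ]; linarith
  set g := g' + 1
  have hM : spectralConst d * 2 ^ g ≤ s * c / 8 := by
    have h0 := one_le_spectralConst d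
    rw [← pow_le_pow_iff_left₀ (by positivity) (by positivity) two_ne_zero]
    calc (spectralConst d * 2 ^ g) ^ 2 = spectralConst d ^ 2 * 4 ^ g := by
          rw [mul_pow, ← pow_mul, mul_comm g, pow_mul]; norm_num
      _ ≤ spectralConst d ^ 2 * (4 * (n * N * p)) := by gcongr
      _ = (256 * spectralConst d ^ 2) * (N * p * n) / 64 := by ring
      _ ≤ C * (N * p * n) / 64 := by gcongr
      _ = (C * N * p * n) / 64 := by ring
      _ ≤ (s * c) ^ 2 / 64 := by gcongr
      _ = _ := by ring
  exact ⟨hs2, hc0, hcN, (mul_le_mul_of_nonneg_right hCd (by positivity)).trans hsnr2,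
    g, hg2.le, hlogle.trans hg2.le, hM⟩

variable {Ω : Type*} [MeasurableSpace Ω] {μ : Measure Ω} [IsProbabilityMeasure μ]
  {W : Edge n d → Ω → ℝ} {p : ℝ}

/-- The tilt `l` minimizes the Bernstein exponent, whose value is `-s c² / (2304 d² N p)`. As `32256
= 14 · 2304`, each pair of a node and a cluster fails with probability at most `2 n^(-14)`, and `2 n
k ≤ n³`. -/
lemma clusterSum_tail (hd : 2 ≤ d) (hn : 2 ≤ n) (hp0 : 0 < p)
    (hm : ∀ e, Measurable (W e)) (hi : iIndepFun W μ)
    (hb : ∀ e, ∀ᵐ ω ∂μ, 0 ≤ W e ω ∧ W e ω ≤ 1) (hp : ∀ e, ∫ ω, W e ω ∂μ ≤ p)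
    (hs : ∀ a, (cluster Φ a).card = s) (hkn : k ≤ n) {c : ℝ} (hc0 : 0 < c)
    (hN : 0 < codegree n d) (hcN : c ≤ codegree n d * p)
    (hsnr : 32256 * (d : ℝ) ^ 2 * (codegree n d * p * Real.log n) ≤ s * c ^ 2) :
    μ.real {ω | ∃ x ∈ (Finset.univ : Finset (Fin n × Fin k)),
      s * c / 24 ≤ |∑ j ∈ cluster Φ x.2, deviation μ W ω x.1 j|} ≤ 1 / (n : ℝ) ^ 11 := by
  have hn0 : (0 : ℝ) < n := by positivity
  have hd0 : (0 : ℝ) < (d : ℝ) ^ 2 := by positivity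
  set N := codegree n d with hNdef
  set l := c / (48 * p * d ^ 2 * N) with hl
  have hl0 : 0 < l := by positivity
  refine (measureReal_exists_le _ _ (c := 2 * (1 / (n : ℝ) ^ 14)) fun x _ => ?_).trans ?_
  · set F : Matrix (Fin n) (Fin n) ℝ :=
      Matrix.of fun i j => if i = x.1 ∧ j ∈ cluster Φ x.2 then 1 else 0 with hF
    have hF01 : ∀ i j, F i j = 0 ∨ F i j = 1 := fun i j => by
      simp only [hF, Matrix.of_apply]; split_ifs <;> simp
    have hentry : ∀ A : Matrix (Fin n) (Fin n) ℝ,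
        entryInner A F = ∑ j ∈ cluster Φ x.2, A x.1 j := fun A => by
      rw [entryInner, Finset.sum_eq_single x.1]
      · simp [hF, Finset.sum_ite_mem]
      · intro b _ hb; simp [hF, hb]
      · simp
    have hsum : ∑ i, ∑ j, F i j ^ 2 = s := by
      have h1 : ∀ i j, F i j ^ 2 = F i j := fun i j => by
        rcases hF01 i j with h | h <;> simp [h]
      have := hentry (Matrix.of fun _ _ => 1)
      simp only [entryInner, Matrix.of_apply, one_mul, Finset.sum_const, hs, nsmul_eq_mul,
        mul_one] at this
      simpa only [h1] using this
    have h := entryInner_deviation_abs hd hp0.le hm hi hb hp (F := F) hl0 (fun i j => by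
      have h1 : l * d ^ 2 ≤ 1 := by
        have : l * d ^ 2 = c / (48 * (N * p)) := by rw [hl]; field_simp
        rw [this, div_le_one (by positivity)]
        nlinarith
      rcases hF01 i j with h | h <;> simp [h, h1]) (l * (s * c / 24))
    simp only [hentry, hsum] at h
    have hset : {ω | l * (s * c / 24) ≤ l * |∑ j ∈ cluster Φ x.2, deviation μ W ω x.1 j|} =
        {ω | s * c / 24 ≤ |∑ j ∈ cluster Φ x.2, deviation μ W ω x.1 j|} := by
      ext ω
      exact mul_le_mul_iff_right₀ hl0
    rw [hset] at h
    refine h.trans (mul_le_mul_of_nonneg_left ?_ zero_le_two)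
    rw [← exp_neg_mul_log (by omega) 14, Real.exp_le_exp]
    have e1 : p * (l ^ 2 * d ^ 2 * (N * s)) - l * (s * c / 24) =
        -(s * c ^ 2 / (2304 * d ^ 2 * (N * p))) := by
      rw [hl]; field_simp; ring
    rw [e1, neg_le_neg_iff, le_div_iff₀ (by positivity)]
    push_cast
    linarith
  · rw [Finset.card_univ, Fintype.card_prod, Fintype.card_fin, Fintype.card_fin]
    push_cast
    have hk : (k : ℝ) ≤ n := by exact_mod_cast hkn
    have h2 : (2 : ℝ) ≤ n := by exact_mod_cast hn
    calc (n : ℝ) * k * (2 * (1 / (n : ℝ) ^ 14)) ≤ n * n * (n * (1 / (n : ℝ) ^ 14)) := by gcongr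
      _ = 1 / (n : ℝ) ^ 11 := by field_simp

/-- Exact recovery of balanced clusters by semidefinite programming. -/
theorem exact_recovery {q : ℝ} (hd : 2 ≤ d) (hdn : d ≤ n) (hW : IsWHPCM μ s p q Φ W)
    (hsnr : recoveryConst d * codegree n d * p * (s * Real.log n + n) ≤
      (s : ℝ) ^ 2 * ((s - 2).choose (d - 2) : ℝ) ^ 2 * (p - q) ^ 2) :
    1 - 6 / (n : ℝ) ^ 11 < μ.real {ω | IsUniqueSDPOptimal (similarityMatrix fun e => W e ω)
      (k * s) (k * s ^ 2) (clusterMatrix Φ)} := by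
  have hn : 2 ≤ n := hd.trans hdn
  have hn2 : (2 : ℝ) ≤ n := by exact_mod_cast hn
  have hn0 : (0 : ℝ) < n := by linarith
  rcases Nat.eq_zero_or_pos k with rfl | hk
  · simp only [isUniqueSDPOptimal_of_no_cluster]
    have : 0 < 6 / (n : ℝ) ^ 11 := by positivity
    have huniv : {ω : Ω | True} = Set.univ := by ext; simp
    rw [huniv, probReal_univ]
    linarith
  have hq0 := hW.zero_le_q
  have hqp := hW.q_lt_p
  have hp0 : 0 < p := hq0.trans_lt hqp
  have hsn : s ≤ n := by
    rw [← hW.balanced ⟨0, hk⟩]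
    exact (Finset.card_le_univ _).trans_eq (Fintype.card_fin n)
  obtain ⟨hs2, hc0, hcN, hsnr2, g, hg, hglog, hM⟩ :=
    snr_consequences hd hdn hsn hq0 hqp hW.p_le_one hsnr
  set c := ((s - 2).choose (d - 2) : ℝ) * (p - q)
  have hN0 : 0 < codegree n d := by exact_mod_cast Nat.choose_pos (by omega)
  have hmean : ∀ e, ∫ ω, W e ω ∂μ ≤ p := fun e => by
    by_cases h : Homogeneous Φ e
    · exact (hW.mean_homogeneous e h).le
    · exact (hW.mean_heterogeneous e h).trans_le hqp.le
  have hkn : k ≤ n := by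
    have hne : ∀ a, ∃ i, Φ i = some a := fun a => by
      have : 0 < (cluster Φ a).card := by rw [hW.balanced]; omega
      obtain ⟨i, hi⟩ := Finset.card_pos.1 this
      exact ⟨i, by simpa [cluster] using hi⟩
    choose f hf using hne
    have hinj : Function.Injective f := fun a b hab => by
      have := hf a
      rw [hab, hf b] at this
      exact (Option.some.inj this).symm
    simpa using Fintype.card_le_of_injective f hinj
  have hbad1 := spectral_tail hd hn hp0.le hW.measurable hW.indep hW.mem_unit hmean hg
    hglog
  have hbad2 := clusterSum_tail hd hn hp0 hW.measurable hW.indep hW.mem_unit hmean hW.balanced hkn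
    hc0 hN0 hcN hsnr2
  set S1 := {ω | ¬ ∀ x, |quadForm (deviation μ W ω) x| ≤ spectralConst d * 2 ^ g * ∑ i, x i ^ 2}
  set S2 := {ω | ∃ x ∈ (Finset.univ : Finset (Fin n × Fin k)),
      s * c / 24 ≤ |∑ j ∈ cluster Φ x.2, deviation μ W ω x.1 j|}
  set S := {ω | IsUniqueSDPOptimal (similarityMatrix fun e => W e ω)
      (k * s) (k * s ^ 2) (clusterMatrix Φ)}
  -- Covering the whole space and using subadditivity avoids any measurability of the recovery
  -- event.
  have hcover : (Set.univ : Set Ω) ⊆ S ∪ (S1 ∪ S2) := by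
    intro ω _
    by_contra hcon
    simp only [Set.mem_union, not_or] at hcon
    obtain ⟨hgood, h1, h2⟩ := hcon
    refine hgood (isUniqueSDPOptimal_of_perturbation (D := deviation μ W ω) (b := codegree n d * q) hs2
      hW.balanced hc0 (fun i j => ?_) (similarityMatrix_symm _) (fun i a => ?_) fun x => ?_)
    · rw [deviation, similarityMatrix_sub, Matrix.sub_apply,
        ← mean_similarity_eq hd hW.balanced hW.mean_homogeneous hW.mean_heterogeneous i j]
      ring
    · by_contra h
      exact h2 ⟨(i, a), Finset.mem_univ _, (not_le.1 h).le⟩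
    · exact (not_not.1 h1 x).trans (mul_le_mul_of_nonneg_right hM
        (Finset.sum_nonneg fun _ _ => sq_nonneg _))
  have hu := (measureReal_mono (μ := μ) hcover).trans (measureReal_union_le _ _)
  have hu2 := measureReal_union_le (μ := μ) S1 S2
  rw [probReal_univ] at hu
  -- The bad events use only `3 + 1`; the spare 2 makes the inequality strict.
  have e : 6 / (n : ℝ) ^ 11 = 3 / (n : ℝ) ^ 11 + 1 / (n : ℝ) ^ 11 + 2 / (n : ℝ) ^ 11 := by ring
  have : 0 < 2 / (n : ℝ) ^ 11 := by positivity
  linarith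

end Recovery

/-! ### Planted cliques as a one-cluster model. -/

section PlantedClique

variable {n d : ℕ}

/-- The labelling with the single cluster `C`. -/
def cliqueLabel (C : Finset (Fin n)) (i : Fin n) : Option (Fin 1) := if i ∈ C then some 0 else none

lemma cluster_cliqueLabel (C : Finset (Fin n)) (a : Fin 1) : cluster (cliqueLabel C) a = C := by
  ext i
  simp [cluster, cliqueLabel, Subsingleton.elim a 0]

lemma clusterMatrix_cliqueLabel (C : Finset (Fin n)) :
    clusterMatrix (cliqueLabel C) = cliqueMatrix C := by
  ext i j
  rw [clusterMatrix_apply]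
  by_cases hi : i ∈ C <;> by_cases hj : j ∈ C <;> simp [cliqueLabel, cliqueMatrix, hi, hj]

lemma homogeneous_cliqueLabel {C : Finset (Fin n)} {e : Edge n d} :
    Homogeneous (cliqueLabel C) e ↔ e.1 ⊆ C := by
  simp [Homogeneous, cluster_cliqueLabel]

lemma isWHPCM_of_isPlantedClique {Ω : Type*} [MeasurableSpace Ω] {μ : Measure Ω}
    {C : Finset (Fin n)} {H : Ω → Set (Edge n d)}
    (hH : IsPlantedClique μ C H) :
    IsWHPCM μ C.card 1 (1 / 2) (cliqueLabel C) fun e ω => edgeIndicator (H ω) e := by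
  have hind : (fun (e : Edge n d) ω => edgeIndicator (H ω) e) =
      fun e => Set.indicator {ω | e ∈ H ω} fun _ => (1 : ℝ) := by
    funext e ω
    by_cases h : e ∈ H ω
    · rw [edgeIndicator, if_pos h, Set.indicator_of_mem (by exact h)]
    · rw [edgeIndicator, if_neg h, Set.indicator_of_notMem (by exact h)]
  have hint : ∀ e : Edge n d, ∫ ω, edgeIndicator (H ω) e ∂μ = μ.real {ω | e ∈ H ω} := fun e => by
    rw [show (fun ω => edgeIndicator (H ω) e) = Set.indicator {ω | e ∈ H ω} fun _ => (1 : ℝ) from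
      congrFun hind e]
    exact integral_indicator_one (hH.measurable e)
  refine ⟨by norm_num, by norm_num, le_rfl, fun a => by rw [cluster_cliqueLabel], fun e => ?_,
    fun e => Filter.Eventually.of_forall fun ω => ?_, ?_, fun e he => ?_, fun e he => ?_⟩
  · rw [show (fun ω => edgeIndicator (H ω) e) = Set.indicator {ω | e ∈ H ω} fun _ => (1 : ℝ) from
      congrFun hind e]
    exact measurable_const.indicator (hH.measurable e)
  · unfold edgeIndicator
    split_ifs <;> norm_num
  · rw [hind]
    exact hH.indep.iIndepFun_indicator
  · rw [hint, hH.prob_inside e (homogeneous_cliqueLabel.1 he)]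
  · rw [hint, hH.prob_outside e fun h => he (homogeneous_cliqueLabel.2 h)]

/-- The ratio of the codegree to the squared codegree inside a set of size at least `√n`. -/
lemma codegree_le_mul_sq (hd : 2 ≤ d) {s : ℕ} (hs : 2 * d ≤ s) (hsn : Real.sqrt n ≤ s) :
    codegree n d ≤ 4 ^ (d - 2) * ((d - 2).factorial : ℝ) ^ 2 *
      ((s - 2).choose (d - 2) : ℝ) ^ 2 := by
  set m := d - 2 with hm
  have h1 : ((s : ℝ) / 2) ^ m ≤ m.factorial * ((s - 2).choose m : ℝ) := by
    have h0 : ((s - 2 + 1 - m : ℕ) : ℝ) ^ m ≤ m.factorial * ((s - 2).choose m : ℝ) := by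
      exact_mod_cast (Nat.pow_sub_le_descFactorial (s - 2) m).trans_eq
        (Nat.descFactorial_eq_factorial_mul_choose _ _)
    refine le_trans (pow_le_pow_left₀ (by positivity) ?_ m) h0
    -- `s ≥ 2 d` gives `s - d + 1 ≥ s / 2`, the smallest factor of the falling factorial.
    have : (s : ℝ) ≤ 2 * ((s - 2 + 1 - m : ℕ) : ℝ) := by exact_mod_cast (by omega)
    linarith
  have h2 : codegree n d ≤ (n : ℝ) ^ m := by
    calc codegree n d ≤ ((n - 2 : ℕ) : ℝ) ^ m := by exact_mod_cast Nat.choose_le_pow _ _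
      _ ≤ _ := by gcongr; exact Nat.sub_le _ _
  have h3 : (n : ℝ) ≤ s ^ 2 := by
    rw [← Real.sqrt_le_left (Nat.cast_nonneg s)]; exact hsn
  calc codegree n d ≤ (n : ℝ) ^ m := h2
    _ ≤ ((s : ℝ) ^ 2) ^ m := by gcongr
    _ = 4 ^ m * (((s : ℝ) / 2) ^ m) ^ 2 := by
      rw [← pow_mul ((s : ℝ) / 2), mul_comm m 2, pow_mul ((s : ℝ) / 2), ← mul_pow]; congr 1; ring
    _ ≤ 4 ^ m * (m.factorial * ((s - 2).choose m : ℝ)) ^ 2 := by gcongr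
    _ = _ := by ring

/-- The constant in the planted clique theorem. -/
def cliqueConst (d : ℕ) : ℝ :=
  12 * recoveryConst d * (4 ^ (d - 2) * ((d - 2).factorial : ℝ) ^ 2) + 2 * d

lemma cliqueConst_pos (d : ℕ) : 0 < cliqueConst d := by
  have := (recoveryConst_bounds d).1
  unfold cliqueConst
  positivity

/-- Exact recovery of planted cliques of order `√n`. -/
theorem clique_recovery {Ω : Type*} [MeasurableSpace Ω] {μ : Measure Ω} [IsProbabilityMeasure μ]
    (hd : 2 ≤ d) (hn : 1 ≤ n) {C : Finset (Fin n)} {H : Ω → Set (Edge n d)}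
    (hH : IsPlantedClique μ C H) (hC : cliqueConst d * Real.sqrt n ≤ C.card) :
    1 - 6 / (n : ℝ) ^ 11 < μ.real {ω | IsUniqueSDPOptimal
      (similarityMatrix (edgeIndicator (H ω))) C.card ((C.card : ℝ) ^ 2) (cliqueMatrix C)} := by
  set s := C.card with hs
  set R := recoveryConst d with hR
  have hR2 : 2 ≤ R := (recoveryConst_bounds d).1
  set B : ℝ := 4 ^ (d - 2) * ((d - 2).factorial : ℝ) ^ 2 with hB
  have hB0 : 0 < B := by positivity
  set K := cliqueConst d with hK
  have hKdef : K = 12 * R * B + 2 * d := rfl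
  have hn1 : (1 : ℝ) ≤ n := by exact_mod_cast hn
  have hsq1 : 1 ≤ Real.sqrt n := Real.one_le_sqrt.2 hn1
  have hd2 : (2 : ℝ) ≤ d := by exact_mod_cast hd
  have hRB : 0 < R * B := by positivity
  have hK1 : 1 ≤ K := by rw [hKdef]; nlinarith
  have hs2d : 2 * d ≤ s := by
    have : (2 * d : ℝ) ≤ s := by nlinarith
    exact_mod_cast this
  have hsn : s ≤ n := (Finset.card_le_univ C).trans_eq (Fintype.card_fin n)
  have hsqs : Real.sqrt n ≤ s := by nlinarith
  have hcod := codegree_le_mul_sq hd hs2d hsqs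
  have hs0 : (0 : ℝ) ≤ s := Nat.cast_nonneg _
  have hlog : Real.log n ≤ 2 * Real.sqrt n := by
    have h1 := Real.log_le_sub_one_of_pos (by linarith : 0 < Real.sqrt n)
    rw [Real.log_sqrt (by linarith)] at h1
    linarith
  -- The factor 12 is `3 · 4`: 3 from `s log n + n ≤ 3 s √n`, and 4 from `(p - q)² = 1/4`.
  have hsum : 12 * R * B * (s * Real.log n + n) ≤ 3 * (s : ℝ) ^ 2 := by
    have h1 : 12 * R * B * Real.sqrt n ≤ s := by
      refine le_trans ?_ hC
      gcongr
      rw [hKdef]; linarith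
    have h3 : (n : ℝ) ≤ Real.sqrt n * s :=
      (Real.mul_self_sqrt (by linarith)).symm.le.trans
        (mul_le_mul_of_nonneg_left hsqs (Real.sqrt_nonneg _))
    calc 12 * R * B * (s * Real.log n + n)
        ≤ 12 * R * B * (s * (2 * Real.sqrt n) + Real.sqrt n * s) := by
          have h4 : (s : ℝ) * Real.log n ≤ s * (2 * Real.sqrt n) :=
            mul_le_mul_of_nonneg_left hlog hs0
          exact mul_le_mul_of_nonneg_left (add_le_add h4 h3) (by positivity)
      _ = 3 * s * (12 * R * B * Real.sqrt n) := by ring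
      _ ≤ 3 * s * s := mul_le_mul_of_nonneg_left h1 (by positivity)
      _ = _ := by ring
  have h := exact_recovery hd (by omega) (isWHPCM_of_isPlantedClique hH) (by
    rw [← hs, ← hR]
    have hsl : 0 ≤ (s : ℝ) * Real.log n + n :=
      add_nonneg (mul_nonneg hs0 (Real.log_nonneg hn1)) (by linarith)
    calc R * codegree n d * 1 * (s * Real.log n + n)
        ≤ R * (B * ((s - 2).choose (d - 2) : ℝ) ^ 2) * 1 * (s * Real.log n + n) := by gcongr
      _ = ((s - 2).choose (d - 2) : ℝ) ^ 2 * (12 * R * B * (s * Real.log n + n)) / 12 := by ring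
      _ ≤ ((s - 2).choose (d - 2) : ℝ) ^ 2 * (3 * (s : ℝ) ^ 2) / 12 := by gcongr
      _ = _ := by ring)
  simpa only [Nat.cast_one, one_mul, clusterMatrix_cliqueLabel] using h

lemma mem_iff_cliqueMatrix_eq_one (C : Finset (Fin n)) (i : Fin n) :
    i ∈ C ↔ cliqueMatrix C i i = 1 := by
  by_cases h : i ∈ C <;> simp [cliqueMatrix, h]

end PlantedClique

end HypergraphClustering

end

theorem theorem5p1 (d : ℕ) (hd : 2 ≤ d) :
    (∃ c₄ : ℝ, 0 < c₄ ∧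
      ∀ (n k s : ℕ) (p q : ℝ) (Φ : Fin n → Option (Fin k))
        (Ω : Type*) [MeasurableSpace Ω] (μ : MeasureTheory.Measure Ω)
        [MeasureTheory.IsProbabilityMeasure μ]
        (W : HypergraphClustering.Edge n d → Ω → ℝ),
        d ≤ n →
        HypergraphClustering.IsWHPCM μ s p q Φ W →
        c₄ * ((n - 2).choose (d - 2) : ℝ) * p * ((s : ℝ) * Real.log (n : ℝ) + (n : ℝ))
          ≤ (s : ℝ) ^ 2 * ((s - 2).choose (d - 2) : ℝ) ^ 2 * (p - q) ^ 2 →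
        1 - 6 / (n : ℝ) ^ 11 <
          μ.real {ω | HypergraphClustering.IsUniqueSDPOptimal
            (HypergraphClustering.similarityMatrix fun e => W e ω)
            ((k : ℝ) * (s : ℝ)) ((k : ℝ) * (s : ℝ) ^ 2)
            (HypergraphClustering.clusterMatrix Φ)}) ∧
    (∃ K : ℝ, 0 < K ∧
      ∀ (n : ℕ) (C : Finset (Fin n))
        (Ω : Type*) [MeasurableSpace Ω] (μ : MeasureTheory.Measure Ω)
        [MeasureTheory.IsProbabilityMeasure μ]
        (H : Ω → Set (HypergraphClustering.Edge n d)),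
        1 ≤ n →
        HypergraphClustering.IsPlantedClique μ C H →
        K * Real.sqrt (n : ℝ) ≤ (C.card : ℝ) →
        1 - 6 / (n : ℝ) ^ 11 <
          μ.real {ω | HypergraphClustering.IsUniqueSDPOptimal
              (HypergraphClustering.similarityMatrix
                (HypergraphClustering.edgeIndicator (H ω)))
              (C.card : ℝ) ((C.card : ℝ) ^ 2)
              (HypergraphClustering.cliqueMatrix C) ∧
            ∀ X, HypergraphClustering.IsSDPOptimal
              (HypergraphClustering.similarityMatrix
                (HypergraphClustering.edgeIndicator (H ω)))
              (C.card : ℝ) ((C.card : ℝ) ^ 2) X →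
              ∀ i, i ∈ C ↔ X i i = 1}) := by
  refine ⟨⟨HypergraphClustering.recoveryConst d, ?_, ?_⟩,
    HypergraphClustering.cliqueConst d, HypergraphClustering.cliqueConst_pos d, ?_⟩
  · linarith [(HypergraphClustering.recoveryConst_bounds d).1]
  · intro n k s p q Φ Ω _ μ _ W hdn hW hsnr
    exact HypergraphClustering.exact_recovery hd hdn hW hsnr
  · intro n C Ω _ μ _ H hn hH hC
    refine (HypergraphClustering.clique_recovery hd hn hH hC).trans_le
      (MeasureTheory.measureReal_mono ?_)
    intro ω hω
    refine ⟨hω, fun X hX i => ?_⟩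
    rw [hω.2 X hX]
    exact HypergraphClustering.mem_iff_cliqueMatrix_eq_one C i
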